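/- Let $K\ge 1$, let $M$ be a compact oriented smooth manifold without boundary of dimension $2K+1$, and let $E$ be a finite-dimensional real vector space. Let $\Omega^\bullet(M,\mathrm{End}(E))$ be the algebra of smooth differential forms on $M$ (of mixed degree) with values in $\mathrm{End}(E)$, with product $(\alpha\otimes\psi)(\beta\otimes\phi)=(\alpha\wedge\beta)\otimes\psi\phi$ and exterior derivative $d$. For $\omega\in\Omega^\bullet(M,\mathrm{End}(E))$ put $F_\omega=d\omega+\omega\wedge\omega$. On the free algebra $\mathbb{R}\langle\omega,d\omega\rangle$ on two symbols $\omega,d\omega$, let $\#$ be the linear map that multiplies each word by its length (invertible on the elements without constant term), and let $\pi:\mathbb{R}\langle\omega,d\omega\rangle\to\Omega^\bullet(M,\mathrm{End}(E))$ be the algebra homomorphism that sends the two symbols to the forms $\omega$ and $d\omega$. Define $$cs_{2,2K}(\omega)=2K\int_M \mathrm{Tr}\Big(\pi\big(\#^{-1}(\omega\,(d\omega+\omega^2)^K)\big)\Big),$$ where $\int_M$ vanishes on components of degree other than $2K+1$. A form $\omega$ is a critical point of $cs_{2,2K}$ with respect to a set of variations if $\frac{d}{dt}\big|_{t=0}cs_{2,2K}(\omega+t\eta)$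 exists and equals $0$ for every variation $\eta$ in that set. Then $cs_{2,2K}$ is a Lagrangian for the $2K$-Maurer–Cartan equation $F_\omega^K=0$: (1) if all components of $\omega\in\Omega^\bullet(M,\mathrm{End}(E))$ have odd degree (for example, if $\omega\in\Omega^1(M,\mathrm{End}(E))$ is a connection form), then $\omega$ is a critical point of $cs_{2,2K}$ with respect to all variations $\eta\in\Omega^\bullet(M,\mathrm{End}(E))$ if and only if $F_\omega^K=0$; (2) if $\omega\in\Omega^1(M,\mathrm{End}(E))$ is a connection form, then $\omega$ is a critical point of $cs_{2,2K}$ with respect to all variations $\eta\in\Omega^1(M,\mathrm{End}(E))$ if and only if $F_\omega^K=0$. -/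

import Mathlib

open scoped Manifold ContDiff TensorProduct

noncomputable section

namespace NFlat

/-! ### Linear algebra of one fibre -/

/-- `Λ• T*`, for a tangent space `T`. -/
abbrev ScalarFiber (T : Type*) [AddCommGroup T] [Module ℝ T] : Type _ :=
  ExteriorAlgebra ℝ (Module.Dual ℝ T)

/-- `Λ• T* ⊗ End E`, whose product is `(α ⊗ ψ)(β ⊗ φ) = (α ∧ β) ⊗ ψφ`. -/
abbrev EndFiber (T E : Type*) [AddCommGroup T] [Module ℝ T] [AddCommGroup E] [Module ℝ E] :
    Type _ :=
  ScalarFiber T ⊗[ℝ] Module.End ℝ E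

section Fibre

variable {S T : Type*} [AddCommGroup S] [Module ℝ S] [AddCommGroup T] [Module ℝ T]

/-- Pull-back of alternating forms along a linear map. -/
def pullScalar (A : S →ₗ[ℝ] T) : ScalarFiber T →ₐ[ℝ] ScalarFiber S :=
  ExteriorAlgebra.map A.dualMap

variable (E : Type*) [AddCommGroup E] [Module ℝ E]

/-- Pull-back of `End E`-valued alternating forms along a linear map. -/
def pullEnd (A : S →ₗ[ℝ] T) : EndFiber T E →ₐ[ℝ] EndFiber S E :=
  Algebra.TensorProduct.map (pullScalar A) (AlgHom.id ℝ (Module.End ℝ E))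

variable (T)

/-- The trace `Λ• T* ⊗ End E → Λ• T*`, `α ⊗ ψ ↦ tr(ψ) α`. -/
def trFiber : EndFiber T E →ₗ[ℝ] ScalarFiber T :=
  (TensorProduct.rid ℝ (ScalarFiber T)).toLinearMap ∘ₗ
    LinearMap.lTensor (ScalarFiber T) (LinearMap.trace ℝ E)

/-- The part `Λᵏ T* ⊗ End E` of degree `k`. -/
def fiberDegree (k : ℕ) : Submodule ℝ (EndFiber T E) :=
  LinearMap.range (LinearMap.rTensor (Module.End ℝ E) (⋀[ℝ]^k (Module.Dual ℝ T)).subtype)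

/-- The sum of the parts of odd degree. -/
def fiberOdd : Submodule ℝ (EndFiber T E) :=
  ⨆ j : ℕ, fiberDegree T E (2 * j + 1)

end Fibre

/-! ### Calculus in coordinates -/

/-- The coordinate space `ℝⁿ`. -/
abbrev Coord (n : ℕ) : Type := EuclideanSpace ℝ (Fin n)

/-- The coordinate covectors `dx₁, …, dxₙ`. -/
def dx (n : ℕ) : Module.Basis (Fin n) ℝ (Module.Dual ℝ (Coord n)) :=
  (EuclideanSpace.basisFun (Fin n) ℝ).toBasis.dualBasis

/-- The monomials `dx_I = dx_{i₁} ∧ ⋯ ∧ dx_{iₖ}`, for `I = {i₁ < ⋯ < iₖ}`. -/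
def dxI (n : ℕ) : Module.Basis (Finset (Fin n)) ℝ (ScalarFiber (Coord n)) :=
  (dx n).ExteriorAlgebra

section Coordinates

variable (n : ℕ) (E : Type*) [AddCommGroup E] [Module ℝ E] [FiniteDimensional ℝ E]

/-- The basis `dx_I ⊗ T_a` of `Λ•(ℝⁿ)* ⊗ End E`, for a basis `T_a` of `End E`. -/
def coordBasis :
    Module.Basis (Finset (Fin n) × Fin (Module.finrank ℝ (Module.End ℝ E))) ℝ
      (EndFiber (Coord n) E) :=
  (dxI n).tensorProduct (Module.finBasis ℝ (Module.End ℝ E))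

variable {n E}

/-- Smoothness on a set of an `End E`-valued form on `ℝⁿ`: all coefficients are smooth. -/
def SmoothOnCoord (f : Coord n → EndFiber (Coord n) E) (s : Set (Coord n)) : Prop :=
  ∀ p, ContDiffOn ℝ ∞ (fun z => (coordBasis n E).coord p (f z)) s

/-- The exterior derivative in coordinates,
`d (∑ f_{I,a} dx_I ⊗ T_a) = ∑ᵢ ∑_{I,a} (∂ᵢ f_{I,a}) (dxᵢ ∧ dx_I) ⊗ T_a`. -/
def extDerivCoord (f : Coord n → EndFiber (Coord n) E) (y : Coord n) : EndFiber (Coord n) E :=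
  ∑ i : Fin n, ∑ p,
    (fderiv ℝ (fun z => (coordBasis n E).coord p (f z)) y (EuclideanSpace.single i 1)) •
      ((ExteriorAlgebra.ι ℝ (dx n i) ⊗ₜ[ℝ] (1 : Module.End ℝ E)) * coordBasis n E p)

end Coordinates

/-! ### Differential forms on a manifold -/

section Forms

variable (n : ℕ) (M : Type*) [TopologicalSpace M] [ChartedSpace (Coord n) M]

/-- Scalar differential forms of mixed degree: sections of `Λ• T*M`, no smoothness required. -/
abbrev ScalarForm : Type _ :=
  ∀ x : M, ScalarFiber (TangentSpace (𝓡 n) x)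

variable (E : Type*) [AddCommGroup E] [Module ℝ E]

/-- Differential forms of mixed degree with values in the endomorphisms of the trivial bundle
`M × E`: sections of `Λ• T*M ⊗ End E`, no smoothness required.  This is an algebra under the
pointwise product `∧`. -/
abbrev EndForm : Type _ :=
  ∀ x : M, EndFiber (TangentSpace (𝓡 n) x) E

variable {n M E}

/-- A scalar form read in the chart `e` (meaningful on `e.target`): its pull-back by `e.symm`. -/
def ScalarForm.inChart (τ : ScalarForm n M) (e : OpenPartialHomeomorph M (Coord n)) :
    Coord n → ScalarFiber (Coord n) :=
  fun y => pullScalar (mfderiv (𝓡 n) (𝓡 n) e.symm y).toLinearMap (τ (e.symm y))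

/-- An `End E`-valued form read in the chart `e` (meaningful on `e.target`). -/
def EndForm.inChart (A : EndForm n M E) (e : OpenPartialHomeomorph M (Coord n)) :
    Coord n → EndFiber (Coord n) E :=
  fun y => pullEnd E (mfderiv (𝓡 n) (𝓡 n) e.symm y).toLinearMap (A (e.symm y))

/-- The trace of an `End E`-valued form. -/
def EndForm.tr (A : EndForm n M E) : ScalarForm n M :=
  fun x => trFiber (TangentSpace (𝓡 n) x) E (A x)

/-- `ω` is a `k`-form. -/
def EndForm.IsOfDegree (A : EndForm n M E) (k : ℕ) : Prop :=
  ∀ x, A x ∈ fiberDegree (TangentSpace (𝓡 n) x) E k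

/-- All components of `ω` of even degree vanish. -/
def EndForm.IsOdd (A : EndForm n M E) : Prop :=
  ∀ x, A x ∈ fiberOdd (TangentSpace (𝓡 n) x) E

variable [FiniteDimensional ℝ E]

/-- `ω` is smooth: its coefficients in the charts of the atlas are smooth. -/
def EndForm.IsSmooth (A : EndForm n M E) : Prop :=
  ∀ e ∈ atlas (Coord n) M, SmoothOnCoord (A.inChart e) e.target

/-- The exterior derivative, computed at each point in a chart around it. -/
def EndForm.d (A : EndForm n M E) : EndForm n M E := fun x =>
  pullEnd E (mfderiv (𝓡 n) (𝓡 n) (chartAt (Coord n) x) x).toLinearMap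
    (extDerivCoord (A.inChart (chartAt (Coord n) x)) (chartAt (Coord n) x x))

/-- The curvature `F_ω = dω + ω ∧ ω`. -/
def EndForm.curvature (A : EndForm n M E) : EndForm n M E :=
  A.d + A * A

end Forms

/-! ### Orientation and integration -/

/-- An orientation of the manifold `M`, given by an oriented atlas: a set of charts of the smooth
structure that covers `M`, with orientation-preserving changes of coordinates. -/
structure OrientedAtlas (n : ℕ) (M : Type*) [TopologicalSpace M] [ChartedSpace (Coord n) M] where
  charts : Set (OpenPartialHomeomorph M (Coord n))
  mem_maximalAtlas : ∀ e ∈ charts, e ∈ IsManifold.maximalAtlas (𝓡 n) ∞ M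
  cover : ∀ x : M, ∃ e ∈ charts, x ∈ e.source
  det_pos : ∀ e ∈ charts, ∀ e' ∈ charts, ∀ y ∈ (e.symm.trans e').source,
    0 < (fderiv ℝ (e' ∘ e.symm) y).det

section Integration

variable {n : ℕ} {M : Type*} [TopologicalSpace M] [ChartedSpace (Coord n) M]

/-- An oriented chart around `x`. -/
def OrientedAtlas.chart (o : OrientedAtlas n M) (x : M) : OpenPartialHomeomorph M (Coord n) :=
  (o.cover x).choose

variable [T2Space M] [CompactSpace M] [IsManifold (𝓡 n) ∞ M]

theorem OrientedAtlas.exists_partition (o : OrientedAtlas n M) :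
    ∃ ρ : SmoothPartitionOfUnity M (𝓡 n) M Set.univ,
      ρ.IsSubordinate fun x => (o.chart x).source :=
  SmoothPartitionOfUnity.exists_isSubordinate (𝓡 n) isClosed_univ _
    (fun x => (o.chart x).open_source)
    (fun x _ => Set.mem_iUnion.2 ⟨x, (o.cover x).choose_spec.2⟩)

/-- A smooth partition of unity subordinate to the oriented charts. -/
def OrientedAtlas.partition (o : OrientedAtlas n M) :
    SmoothPartitionOfUnity M (𝓡 n) M Set.univ :=
  o.exists_partition.choose

/-- The integral `∫_M τ` over a compact oriented manifold:
`∑ᵢ ∫_{ℝⁿ} (ρᵢ τ)_{1…n} dx₁ ⋯ dxₙ`, where `(ρᵢ τ)_{1…n}` is the coefficient of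
`dx₁ ∧ ⋯ ∧ dxₙ` of `ρᵢ τ` in the `i`-th oriented chart. Components of degree other than `n` do
not contribute. -/
def OrientedAtlas.integral (o : OrientedAtlas n M) (τ : ScalarForm n M) : ℝ :=
  ∑ᶠ i : M, ∫ y in (o.chart i).target,
    (dxI n).coord Finset.univ
      (ScalarForm.inChart (fun x => o.partition i x • τ x) (o.chart i) y)

end Integration

/-! ### The free algebra `ℝ⟨ω, dω⟩` -/

/-- The two symbols `ω` and `dω`. -/
inductive Letter
  | form
  | dform

/-- The word `w` as an element of the free algebra. -/
def wordElem (w : FreeMonoid Letter) : FreeAlgebra ℝ Letter :=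
  FreeMonoid.lift (FreeAlgebra.ι ℝ) w

/-- The linear endomorphism of `ℝ⟨ω, dω⟩` that multiplies each word `w` by `c w`. -/
def scaleWords (c : FreeMonoid Letter → ℝ) : FreeAlgebra ℝ Letter →ₗ[ℝ] FreeAlgebra ℝ Letter :=
  (Finsupp.lsum ℝ fun w => LinearMap.toSpanSingleton ℝ _ (c w • wordElem w)) ∘ₗ
    (MonoidAlgebra.coeffLinearEquiv ℝ).toLinearMap ∘ₗ
      (FreeAlgebra.equivMonoidAlgebraFreeMonoid (R := ℝ) (X := Letter)).toLinearMap

/-- `#`: each word is multiplied by its length. -/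
def sharp : FreeAlgebra ℝ Letter →ₗ[ℝ] FreeAlgebra ℝ Letter :=
  scaleWords fun w => (w.length : ℝ)

/-- `#⁻¹`: each non-empty word is divided by its length.  (The empty word, which is not in the
image of `#`, is sent to `0`.)  It is the inverse of `#` on the elements without constant term. -/
def sharpInv : FreeAlgebra ℝ Letter →ₗ[ℝ] FreeAlgebra ℝ Letter :=
  scaleWords fun w => (w.length : ℝ)⁻¹

theorem scaleWords_wordElem (c : FreeMonoid Letter → ℝ) (w : FreeMonoid Letter) :
    scaleWords c (wordElem w) = c w • wordElem w := by
  have h : (FreeAlgebra.equivMonoidAlgebraFreeMonoid (R := ℝ) (X := Letter)) (wordElem w) =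
      MonoidAlgebra.single w 1 := by
    rw [← AlgEquiv.eq_symm_apply]
    simp [FreeAlgebra.equivMonoidAlgebraFreeMonoid, wordElem]
  have h2 : (MonoidAlgebra.coeffLinearEquiv ℝ) (MonoidAlgebra.single w (1 : ℝ)) =
      Finsupp.single w 1 := rfl
  simp [scaleWords, h, h2]

theorem span_wordElem : Submodule.span ℝ (Set.range wordElem) = ⊤ := by
  refine Submodule.eq_top_iff'.2 fun x => ?_
  obtain ⟨y, rfl⟩ := (FreeAlgebra.equivMonoidAlgebraFreeMonoid (R := ℝ) (X := Letter)).symm.surjective x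
  induction y using MonoidAlgebra.induction_linear with
  | zero => simp
  | add f g hf hg => rw [map_add]; exact Submodule.add_mem _ hf hg
  | single w r =>
    have : (FreeAlgebra.equivMonoidAlgebraFreeMonoid (R := ℝ) (X := Letter)).symm
        (MonoidAlgebra.single w r) = r • wordElem w := by
      simp [FreeAlgebra.equivMonoidAlgebraFreeMonoid, wordElem]
    rw [this]
    exact Submodule.smul_mem _ _ (Submodule.subset_span ⟨w, rfl⟩)

/-- `#⁻¹` inverts `#` on the elements without constant term. -/
theorem sharp_sharpInv (x : FreeAlgebra ℝ Letter) (hx : FreeAlgebra.algebraMapInv x = 0) :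
    sharp (sharpInv x) = x ∧ sharpInv (sharp x) = x := by
  have key : ∀ x : FreeAlgebra ℝ Letter,
      sharp (sharpInv x) = x - algebraMap ℝ _ (FreeAlgebra.algebraMapInv x) ∧
      sharpInv (sharp x) = x - algebraMap ℝ _ (FreeAlgebra.algebraMapInv x) := by
    intro x
    have hx : x ∈ Submodule.span ℝ (Set.range wordElem) := by rw [span_wordElem]; trivial
    induction hx using Submodule.span_induction with
    | mem x hx =>
      obtain ⟨w, rfl⟩ := hx
      rw [sharpInv, sharp, scaleWords_wordElem, map_smul, scaleWords_wordElem, map_smul,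
        scaleWords_wordElem]
      induction w using FreeMonoid.casesOn with
      | one => simp [wordElem]
      | of_mul a w =>
        have h1 : FreeAlgebra.algebraMapInv (wordElem (FreeMonoid.of a * w)) = (0 : ℝ) := by
          simp [wordElem, FreeAlgebra.algebraMapInv]
        have h2 : ((FreeMonoid.of a * w).length : ℝ) ≠ 0 := by
          simp only [FreeMonoid.length_mul, FreeMonoid.length_of]; positivity
        rw [h1]
        simp [smul_smul, h2, -FreeMonoid.length_mul]
    | zero => simp
    | add x y _ _ hx hy =>
      simp only [map_add, hx, hy]
      constructor <;> abel
    | smul r x _ hx =>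
      simp only [map_smul, hx, smul_sub, Algebra.algebraMap_eq_smul_one, smul_assoc]
      simp
  simpa [hx] using key x

/-- The element `ω (dω + ω²)^K` of the free algebra. -/
def csElem (K : ℕ) : FreeAlgebra ℝ Letter :=
  FreeAlgebra.ι ℝ .form * (FreeAlgebra.ι ℝ .dform + FreeAlgebra.ι ℝ .form ^ 2) ^ K

theorem csElem_no_constant (K : ℕ) : FreeAlgebra.algebraMapInv (csElem K) = 0 := by
  simp [csElem, FreeAlgebra.algebraMapInv]

section ChernSimons

variable {n : ℕ} {M : Type*} [TopologicalSpace M] [ChartedSpace (Coord n) M]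
  {E : Type*} [AddCommGroup E] [Module ℝ E] [FiniteDimensional ℝ E]

/-- The form denoted by a symbol. -/
def EndForm.letter (A : EndForm n M E) : Letter → EndForm n M E
  | .form => A
  | .dform => A.d

/-- The canonical projection `π : ℝ⟨ω, dω⟩ → Ω•(M, End E)`. -/
def EndForm.proj (A : EndForm n M E) : FreeAlgebra ℝ Letter →ₐ[ℝ] EndForm n M E :=
  FreeAlgebra.lift ℝ A.letter

/-- The Chern–Simons functional
`cs_{2,2K}(ω) = 2K ∫_M Tr(π(#⁻¹(ω (dω + ω²)^K)))`. -/
def chernSimons [T2Space M] [CompactSpace M] [IsManifold (𝓡 n) ∞ M]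
    (o : OrientedAtlas n M) (K : ℕ) (A : EndForm n M E) : ℝ :=
  2 * (K : ℝ) * o.integral (EndForm.tr (A.proj (sharpInv (csElem K))))

/-- `ω` is a critical point of `f` for variations in the set `D`: for every `η` in `D` the
derivative of `t ↦ f (ω + t η)` at `0` exists and vanishes. -/
def IsCriticalPoint (f : EndForm n M E → ℝ) (D : Set (EndForm n M E)) (A : EndForm n M E) :
    Prop :=
  ∀ η ∈ D, HasDerivAt (fun t : ℝ => f (A + t • η)) 0 0

end ChernSimons

end NFlat

end

/-! Both equivalences follow from the first variation formula: for odd `ω`, the derivative of `cs`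
at `ω` along `η` is `2K ∫ Tr(η F_ω^K)` (`hasDerivAt_chernSimons`). As `2K ≠ 0`, criticality says
that `F_ω^K` pairs to zero with every admissible `η`, and it remains to see that this pairing is
nondegenerate.

The formula is algebraic and is proved for any `ClosedTrace` (`ClosedTrace.hasDerivAt_int`). Since
`∫₀¹ t^m dt = 1/(m+1)`, the operator `#⁻¹` applied to `ω y` is the integral over `t ∈ [0,1]` of `ω`
times `y` with both symbols scaled by `t` (`intervalIntegral_scaleLetters`). So the functional is
`∫₀¹ ∫ Tr(ω F_t^K) dt` with `F_t = t dω + t² ω²`, the curvature of `tω`. Vary `ω` by `η`, integrate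
by parts, and use the Bianchi identity `d F_t^j = t [F_t^j, ω]`: the integrand becomes `d/dt ∫ Tr(tη
F_t^K)` (`int_variation_term`), and the fundamental theorem of calculus leaves the value at `t = 1`.

Smooth forms on `M` are a `ClosedTrace` for two reasons. The integral is an ungraded trace because
`n` is odd: of two homogeneous factors of total degree `n` one is even, so they commute
(`dxI_coord_univ_mul_comm`). Stokes' theorem holds (`smoothInt_smoothD`) by a partition of unity,
the naturality of `d` under changes of charts (`extDerivCoord_pullAlong`) and integration by parts
in `ℝⁿ`.

For nondegeneracy, take in a chart the test form `η = ρ ∑ₚ topTr(eₚ G) eₚ`, where the `eₚ` are basis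
elements. The top coefficient of `Tr(η G)` is `ρ ∑ₚ topTr(eₚ G)² ≥ 0`, so a vanishing integral
forces every `topTr(eₚ G)` to vanish where `ρ ≠ 0`; wedge duality and the trace form of `End E` then
give `G = 0`. If `ω` is a one-form, `G = F_ω^K` has degree `2K = n - 1`, and the `eₚ` of degree one
suffice. -/

noncomputable section

namespace NFlat

/-! ### The first variation in a graded algebra with a closed trace -/

section Variation

open Polynomial

/-- The two letters read in a ring with a map `d`. -/
def lettersIn {R : Type*} (d : R → R) (a : R) : Letter → R
  | .form => a
  | .dform => d a

/-- A differential `ℤ/2`-graded algebra with a closed trace: `invol` is the grading involution and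
the integral is a trace in the ungraded sense. -/
structure ClosedTrace (R : Type*) [Ring R] [Algebra ℝ R] where
  d : R →ₗ[ℝ] R
  invol : R →ₐ[ℝ] R
  int : R →ₗ[ℝ] ℝ
  leibniz : ∀ x y, d (x * y) = d x * y + invol x * d y
  d_d : ∀ x, d (d x) = 0
  invol_d : ∀ x, invol (d x) = -d (invol x)
  int_comm : ∀ x y, int (x * y) = int (y * x)
  int_d : ∀ x, int (d x) = 0

/-- The factor `D x` does not commute with the powers of `p x`, so the power rule is a sum over its
positions. It serves both the derivative in `t` and the derivative along the variation. -/
theorem derivation_pow {A R : Type*} [Ring A] [Ring R] (p : A →+* R) (D : A → R)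
    (h1 : D 1 = 0) (hD : ∀ x y, D (x * y) = D x * p y + p x * D y) (x : A) (n : ℕ) :
    D (x ^ n) = ∑ i ∈ Finset.range n, p x ^ i * D x * p x ^ (n - 1 - i) := by
  induction n with
  | zero => simp [h1]
  | succ n ih =>
    rw [pow_succ, hD, ih, Finset.sum_range_succ, Finset.sum_mul]
    congr 1
    · refine Finset.sum_congr rfl fun i hi => ?_
      have : n + 1 - 1 - i = (n - 1 - i) + 1 := by
        have := Finset.mem_range.1 hi
        omega
      rw [this, pow_succ, mul_assoc (_ * _)]
    · simp

variable {R : Type*} [Ring R] [Algebra ℝ R]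

/-- Evaluation of polynomials at a real number. -/
def evalReal (R : Type*) [Ring R] [Algebra ℝ R] (s : ℝ) : R[X] →ₐ[ℝ] R :=
  { eval₂RingHom' (RingHom.id R) (algebraMap ℝ R s) (fun r => (Algebra.commutes s r).symm) with
    commutes' := fun r => by
      change eval₂ (RingHom.id R) _ (algebraMap ℝ R[X] r) = _
      rw [Polynomial.algebraMap_apply, eval₂_C]; rfl }

theorem evalReal_X (s : ℝ) : evalReal R s X = algebraMap ℝ R s :=
  eval₂_X _ _

theorem evalReal_C (s : ℝ) (r : R) : evalReal R s (C r) = r :=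
  eval₂_C _ _

/-- After `J` is applied, the value at `s` is an ordinary real polynomial in `s`; no topology on `R`
is needed. -/
theorem hasDerivAt_evalReal (J : R →ₗ[ℝ] ℝ) (P : R[X]) (s : ℝ) :
    HasDerivAt (fun s : ℝ => J (evalReal R s P)) (J (evalReal R s (derivative P))) s := by
  induction P using Polynomial.induction_on' with
  | add p q hp hq => simpa only [map_add] using hp.fun_add hq
  | monomial n c =>
    have h : ∀ (m : ℕ) (c : R) (s : ℝ), J (evalReal R s (monomial m c)) = s ^ m * J c := by
      intro m c s
      rw [← C_mul_X_pow_eq_monomial, map_mul, map_pow, evalReal_X, evalReal_C, ← map_pow,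
        ← Algebra.commutes, ← Algebra.smul_def, map_smul, smul_eq_mul]
    rw [derivative_monomial]
    simp only [h]
    have h2 : J (c * (n : R)) = n * J c := by
      rw [← nsmul_eq_mul', map_nsmul, nsmul_eq_mul]
    rw [h2]
    exact ((hasDerivAt_pow n s).mul_const (J c)).congr_deriv (by ring)

/-- The substitution `ω ↦ tω`, `dω ↦ t dω`. -/
def scaleLetters (t : ℝ) : FreeAlgebra ℝ Letter →ₐ[ℝ] FreeAlgebra ℝ Letter :=
  FreeAlgebra.lift ℝ fun l => t • FreeAlgebra.ι ℝ l

theorem wordElem_mul (v w : FreeMonoid Letter) : wordElem (v * w) = wordElem v * wordElem w :=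
  map_mul _ _ _

theorem wordElem_of (l : Letter) : wordElem (FreeMonoid.of l) = FreeAlgebra.ι ℝ l :=
  FreeMonoid.lift_eval_of _ _

theorem scaleLetters_wordElem (t : ℝ) (w : FreeMonoid Letter) :
    scaleLetters t (wordElem w) = t ^ w.length • wordElem w := by
  induction w using FreeMonoid.inductionOn' with
  | one => simp [wordElem]
  | of_mul l w ih =>
    rw [wordElem_mul, map_mul, ih, wordElem_of, scaleLetters, FreeAlgebra.lift_ι_apply,
      smul_mul_smul_comm, FreeMonoid.length_mul, FreeMonoid.length_of, pow_add, pow_one]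

/-- A word of length `m` acquires the factor `t ^ m`, whose integral `1 / (m + 1)` is the inverse
length of the word with `ω` put in front. Continuity is carried along because additivity of the
integral requires integrability. -/
theorem intervalIntegral_scaleLetters (f : FreeAlgebra ℝ Letter →ₗ[ℝ] ℝ)
    (y : FreeAlgebra ℝ Letter) :
    Continuous (fun t : ℝ => f (FreeAlgebra.ι ℝ .form * scaleLetters t y)) ∧
    ∫ t in (0 : ℝ)..1, f (FreeAlgebra.ι ℝ .form * scaleLetters t y) =
      f (sharpInv (FreeAlgebra.ι ℝ .form * y)) := by
  have hy : y ∈ Submodule.span ℝ (Set.range wordElem) := by rw [span_wordElem]; trivial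
  induction hy using Submodule.span_induction with
  | mem y hy =>
    obtain ⟨w, rfl⟩ := hy
    have h : ∀ t : ℝ, f (FreeAlgebra.ι ℝ .form * scaleLetters t (wordElem w)) =
        t ^ w.length * f (FreeAlgebra.ι ℝ .form * wordElem w) := by
      intro t
      rw [scaleLetters_wordElem, mul_smul_comm, map_smul, smul_eq_mul]
    simp only [h]
    refine ⟨by fun_prop, ?_⟩
    rw [intervalIntegral.integral_mul_const, integral_pow, ← wordElem_of, ← wordElem_mul,
      sharpInv, scaleWords_wordElem, map_smul, smul_eq_mul, FreeMonoid.length_mul,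
      FreeMonoid.length_of]
    push_cast
    rw [add_comm (1 : ℝ)]
    simp
  | zero => simp [continuous_const]
  | add x y _ _ hx hy =>
    simp only [map_add, mul_add]
    refine ⟨hx.1.add hy.1, ?_⟩
    rw [intervalIntegral.integral_add (hx.1.intervalIntegrable _ _) (hy.1.intervalIntegrable _ _),
      hx.2, hy.2]
  | smul r x _ hx =>
    simp only [map_smul, mul_smul_comm, smul_eq_mul]
    refine ⟨continuous_const.mul hx.1, ?_⟩
    rw [intervalIntegral.integral_const_mul, hx.2]

/-! ### Integration by parts and the first variation formula -/

namespace ClosedTrace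

variable (S : ClosedTrace R) {a : R}

/-- `F = t da + t² a²` is the curvature of `t a`. It is even, and `dF = [F, t a]` because the cubic
terms cancel. The commutator with `t a` is a derivation, so the identity passes to powers. -/
theorem bianchi (ha : S.invol a = -a) (t : ℝ) (j : ℕ) :
    S.invol ((t • S.d a + t ^ 2 • (a * a)) ^ j) = (t • S.d a + t ^ 2 • (a * a)) ^ j ∧
    S.d ((t • S.d a + t ^ 2 • (a * a)) ^ j) =
      t • ((t • S.d a + t ^ 2 • (a * a)) ^ j * a - a * (t • S.d a + t ^ 2 • (a * a)) ^ j) := by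
  set F := t • S.d a + t ^ 2 • (a * a) with hF
  have h0 : S.invol F = F := by
    simp [hF, S.invol_d, ha]
  have h1 : S.d F = t • (F * a - a * F) := by
    simp only [hF, map_add, map_smul, S.d_d, S.leibniz, ha, smul_zero, zero_add, add_mul, mul_add,
      smul_mul_assoc, mul_smul_comm, mul_assoc, smul_sub, smul_add, smul_smul, neg_mul]
    module
  induction j with
  | zero =>
    have : S.d 1 = 0 := by simpa using S.leibniz 1 1
    simp [this]
  | succ j ih =>
    refine ⟨by rw [map_pow, h0], ?_⟩
    rw [pow_succ, S.leibniz, ih.1, ih.2, h1]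
    simp only [smul_mul_assoc, mul_smul_comm, sub_mul, mul_sub, mul_assoc, smul_sub]
    abel

/-- With `x = F^j a F^i`, cyclicity brings the left side to `int (x (t db + t² (ab + ba)))`.
Integration by parts moves `d` from `b` to `x`. By Bianchi, `dx` contains `-t (ax + xa)`, which
cancels the `t²` terms. What is left contains `da + 2t a²`, the `t`-derivative of `F`. -/
theorem int_variation_term (ha : S.invol a = -a) (b : R) (t : ℝ) (i j : ℕ) :
    S.int (a * ((t • S.d a + t ^ 2 • (a * a)) ^ i * (t • S.d b + t ^ 2 • (a * b + b * a)) *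
      (t • S.d a + t ^ 2 • (a * a)) ^ j)) =
    t * S.int (b * ((t • S.d a + t ^ 2 • (a * a)) ^ j * (S.d a + (2 * t) • (a * a)) *
      (t • S.d a + t ^ 2 • (a * a)) ^ i)) := by
  obtain ⟨hi, hdi⟩ := S.bianchi ha t i
  obtain ⟨hj, hdj⟩ := S.bianchi ha t j
  set Fi := (t • S.d a + t ^ 2 • (a * a)) ^ i
  set Fj := (t • S.d a + t ^ 2 • (a * a)) ^ j
  set x := Fj * (a * Fi) with hx
  have hdx : S.d x = Fj * (S.d a + (2 * t) • (a * a)) * Fi - t • (a * x + x * a) := by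
    simp only [hx, S.leibniz, hdi, hdj, hj, ha, add_mul, mul_add, sub_mul, mul_sub,
      smul_mul_assoc, mul_smul_comm, mul_assoc, neg_mul, mul_neg, smul_sub, smul_add]
    module
  -- `x` is odd, so `d (x b) = dx b - x db`, and its integral is zero.
  have hpart : S.int (x * S.d b) = S.int (S.d x * b) := by
    have h := S.int_d (x * b)
    have hxo : S.invol x = -x := by simp [hx, hi, hj, ha]
    rw [S.leibniz, hxo, map_add, neg_mul, map_neg] at h
    linarith
  have e1 : S.int (a * (Fi * (t • S.d b + t ^ 2 • (a * b + b * a)) * Fj)) =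
      S.int (x * (t • S.d b + t ^ 2 • (a * b + b * a))) := by
    rw [← mul_assoc, S.int_comm, hx]
    simp only [mul_assoc]
  have e2 : S.int (x * (b * a)) = S.int (a * x * b) := by
    rw [← mul_assoc x b a, S.int_comm (x * b) a, mul_assoc a x b]
  rw [e1, S.int_comm b, mul_add, mul_smul_comm, mul_smul_comm, mul_add, map_add, map_smul, map_smul,
    map_add, hpart, e2, ← mul_assoc x, hdx, sub_mul, map_sub, smul_mul_assoc, map_smul, add_mul,
    map_add]
  simp only [smul_eq_mul]
  ring

theorem hasDerivAt_int (ha : S.invol a = -a) (b : R) (K : ℕ) :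
    HasDerivAt (fun s : ℝ => S.int (FreeAlgebra.lift ℝ (lettersIn S.d (a + s • b))
      (sharpInv (csElem K)))) (S.int (b * (S.d a + a * a) ^ K)) 0 := by
  -- `Ψ` reads the letters along the line `a + X b`; evaluating `X` at `s` gives the forms built
  -- from `a + s b`.
  let Ψ : FreeAlgebra ℝ Letter →ₐ[ℝ] R[X] := FreeAlgebra.lift ℝ fun l =>
    C (lettersIn S.d a l) + X * C (lettersIn S.d b l)
  have hΨ : ∀ s : ℝ, FreeAlgebra.lift ℝ (lettersIn S.d (a + s • b)) = (evalReal R s).comp Ψ := by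
    intro s
    refine FreeAlgebra.hom_ext (funext fun l => ?_)
    simp only [Function.comp_apply, FreeAlgebra.lift_ι_apply, AlgHom.comp_apply, Ψ, map_add,
      map_mul, evalReal_C, evalReal_X, ← Algebra.smul_def]
    cases l <;> simp [lettersIn]
  have hd := hasDerivAt_evalReal S.int (Ψ (sharpInv (csElem K))) 0
  simp only [hΨ, AlgHom.comp_apply]
  convert hd using 1
  -- The derivative along `b` at `a`: a derivation over the evaluation of the letters at `a`.
  let D : FreeAlgebra ℝ Letter →ₗ[ℝ] R :=
    (evalReal R 0).toLinearMap ∘ₗ (derivative.restrictScalars ℝ) ∘ₗ Ψ.toLinearMap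
  have hD : ∀ x y, D (x * y) =
      D x * ((evalReal R 0).comp Ψ) y + ((evalReal R 0).comp Ψ) x * D y := by
    intro x y
    simp [D, derivative_mul]
  have hDι : ∀ l, D (FreeAlgebra.ι ℝ l) = lettersIn S.d b l := by
    intro l
    simp [D, Ψ, derivative_mul, evalReal_C]
  have hpι : ∀ l, ((evalReal R 0).comp Ψ) (FreeAlgebra.ι ℝ l) = lettersIn S.d a l := by
    intro l
    simp [Ψ, evalReal_C, evalReal_X]
  change _ = S.int (D (sharpInv (csElem K)))
  have hint := intervalIntegral_scaleLetters (S.int ∘ₗ D)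
    ((FreeAlgebra.ι ℝ .dform + FreeAlgebra.ι ℝ .form ^ 2) ^ K)
  -- At `X = t` this is the curvature of `t a`. The polynomial `X b P^K` is the antiderivative of
  -- the integrand; it vanishes at `0` and equals `b (da + a²)^K` at `1`.
  set P : R[X] := X * C (S.d a) + X ^ 2 * C (a * a) with hP
  have hG := fun t : ℝ => hasDerivAt_evalReal S.int (X * C b * P ^ K) t
  have hkey : ∀ t : ℝ, S.int (evalReal R t (derivative (X * C b * P ^ K))) =
      (S.int ∘ₗ D) (FreeAlgebra.ι ℝ .form * scaleLetters t
        ((FreeAlgebra.ι ℝ .dform + FreeAlgebra.ι ℝ .form ^ 2) ^ K)) := by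
    intro t
    have hPt : evalReal R t P = t • S.d a + t ^ 2 • (a * a) := by
      simp only [hP, map_add, map_mul, map_pow, evalReal_X, evalReal_C]
      rw [← map_pow, ← Algebra.smul_def, ← Algebra.smul_def]
    have hPt' : evalReal R t (derivative P) = S.d a + (2 * t) • (a * a) := by
      simp only [hP, map_add, map_mul, derivative_mul, derivative_X, derivative_C, derivative_X_pow,
        evalReal_X, evalReal_C, Algebra.smul_def, map_natCast, map_ofNat, map_pow]
      simp
    have hx : scaleLetters t (FreeAlgebra.ι ℝ .dform + FreeAlgebra.ι ℝ .form ^ 2) =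
        t • FreeAlgebra.ι ℝ .dform + t ^ 2 • (FreeAlgebra.ι ℝ .form * FreeAlgebra.ι ℝ .form) := by
      simp [scaleLetters, pow_two, smul_smul]
    set x := scaleLetters t (FreeAlgebra.ι ℝ .dform + FreeAlgebra.ι ℝ .form ^ 2)
    have hpx : ((evalReal R 0).comp Ψ) x = t • S.d a + t ^ 2 • (a * a) := by
      rw [hx, map_add, map_smul, map_smul, map_mul, hpι, hpι]
      rfl
    have hDx : D x = t • S.d b + t ^ 2 • (a * b + b * a) := by
      rw [hx, map_add, map_smul, map_smul, hD, hpι, hDι, hDι]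
      simp only [lettersIn]
      rw [add_comm (b * a)]
    have p1 := derivation_pow (evalReal R t : R[X] →+* R)
      (fun q => evalReal R t (derivative q)) (by simp) (by intro x y; simp [derivative_mul]) P K
    have p2 := derivation_pow ((evalReal R 0).comp Ψ : FreeAlgebra ℝ Letter →+* R) D
      (by simp [D]) hD x K
    simp only [RingHom.coe_coe, hPt, hPt', hpx, hDx] at p1 p2
    have hder : derivative (X * C b * P ^ K) = C b * P ^ K + X * (C b * derivative (P ^ K)) := by
      simp only [derivative_mul, derivative_X, derivative_C, zero_mul, zero_add,
        one_mul, mul_assoc]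
    rw [map_pow, LinearMap.comp_apply, hD, hDι, hpι, map_pow, hpx, p2, hder, map_add,
      map_mul, map_mul, map_mul, p1, map_pow, hPt, evalReal_X, evalReal_C, map_add, map_add]
    simp only [lettersIn]
    congr 1
    -- `int_variation_term` interchanges the exponents `i` and `K - 1 - i`, so one of the two sums
    -- is reflected before they are compared term by term.
    rw [← Algebra.smul_def, map_smul, smul_eq_mul, Finset.mul_sum, Finset.mul_sum,
      map_sum, map_sum, Finset.mul_sum, ← Finset.sum_range_reflect]
    refine Finset.sum_congr rfl fun i hi => ?_
    have hi' : K - 1 - (K - 1 - i) = i := by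
      have := Finset.mem_range.1 hi
      omega
    rw [hi', S.int_variation_term ha]
  have hftc := intervalIntegral.integral_eq_sub_of_hasDerivAt (a := 0) (b := 1) (fun t _ => hG t)
    (by simp only [hkey]; exact hint.1.intervalIntegrable _ _)
  simp only [hkey, hint.2] at hftc
  change S.int (D (sharpInv (csElem K))) = _ at hftc
  rw [hftc]
  simp [hP, evalReal_X, evalReal_C]

end ClosedTrace

end Variation

/-! ### Algebra of one fibre -/

section FibreAlgebra

variable {R S T : Type*} [AddCommGroup R] [Module ℝ R] [AddCommGroup S] [Module ℝ S]
  [AddCommGroup T] [Module ℝ T]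

theorem pullScalar_ι (A : S →ₗ[ℝ] T) (ξ : Module.Dual ℝ T) :
    pullScalar A (ExteriorAlgebra.ι ℝ ξ) = ExteriorAlgebra.ι ℝ (ξ ∘ₗ A) :=
  ExteriorAlgebra.map_apply_ι _ _

theorem pullScalar_comp (A : S →ₗ[ℝ] T) (B : R →ₗ[ℝ] S) (v : ScalarFiber T) :
    pullScalar (A ∘ₗ B) v = pullScalar B (pullScalar A v) := by
  rw [pullScalar, pullScalar, pullScalar, ← AlgHom.comp_apply, ExteriorAlgebra.map_comp_map]
  rfl

theorem pullScalar_id (v : ScalarFiber T) : pullScalar LinearMap.id v = v := by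
  have : (LinearMap.id : T →ₗ[ℝ] T).dualMap = LinearMap.id := LinearMap.dualMap_id
  rw [pullScalar, this, ExteriorAlgebra.map_id, AlgHom.id_apply]

variable (E : Type*) [AddCommGroup E] [Module ℝ E]

theorem pullEnd_tmul (A : S →ₗ[ℝ] T) (a : ScalarFiber T) (ψ : Module.End ℝ E) :
    pullEnd E A (a ⊗ₜ[ℝ] ψ) = pullScalar A a ⊗ₜ[ℝ] ψ := by
  simp [pullEnd]

theorem pullEnd_comp (A : S →ₗ[ℝ] T) (B : R →ₗ[ℝ] S) (v : EndFiber T E) :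
    pullEnd E (A ∘ₗ B) v = pullEnd E B (pullEnd E A v) := by
  induction v using TensorProduct.induction_on with
  | zero => simp
  | tmul a ψ => simp only [pullEnd_tmul, pullScalar_comp]
  | add v w hv hw => simp only [map_add, hv, hw]

theorem pullEnd_id (v : EndFiber T E) : pullEnd E LinearMap.id v = v := by
  induction v using TensorProduct.induction_on with
  | zero => simp
  | tmul a ψ => simp only [pullEnd_tmul, pullScalar_id]
  | add v w hv hw => simp only [map_add, hv, hw]

theorem trFiber_tmul (a : ScalarFiber T) (ψ : Module.End ℝ E) :
    trFiber T E (a ⊗ₜ[ℝ] ψ) = LinearMap.trace ℝ E ψ • a := by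
  simp [trFiber]

theorem trFiber_pullEnd (A : S →ₗ[ℝ] T) (v : EndFiber T E) :
    trFiber S E (pullEnd E A v) = pullScalar A (trFiber T E v) := by
  induction v using TensorProduct.induction_on with
  | zero => simp
  | tmul a ψ => simp only [pullEnd_tmul, trFiber_tmul, map_smul]
  | add v w hv hw => simp only [map_add, hv, hw]

/-- The algebra endomorphism that multiplies the part of degree `k` by `c ^ k`. -/
def scaleEnd (T E : Type*) [AddCommGroup T] [Module ℝ T] [AddCommGroup E] [Module ℝ E] (c : ℝ) :
    EndFiber T E →ₐ[ℝ] EndFiber T E :=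
  pullEnd E (c • LinearMap.id)

/-- Homotheties commute with every linear map. Hence the grading, encoded by `scaleEnd`, is
respected by all changes of coordinates. -/
theorem scaleEnd_pullEnd (A : S →ₗ[ℝ] T) (c : ℝ) (v : EndFiber T E) :
    scaleEnd S E c (pullEnd E A v) = pullEnd E A (scaleEnd T E c v) := by
  rw [scaleEnd, scaleEnd, ← pullEnd_comp, ← pullEnd_comp, LinearMap.comp_smul,
    LinearMap.smul_comp, LinearMap.comp_id, LinearMap.id_comp]

theorem scaleEnd_tmul (c : ℝ) (a : ScalarFiber T) (ψ : Module.End ℝ E) :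
    scaleEnd T E c (a ⊗ₜ[ℝ] ψ) = pullScalar (c • LinearMap.id) a ⊗ₜ[ℝ] ψ :=
  pullEnd_tmul _ _ _ _

theorem pullScalar_smul_ι (c : ℝ) (ξ : Module.Dual ℝ T) :
    pullScalar (c • LinearMap.id : T →ₗ[ℝ] T) (ExteriorAlgebra.ι ℝ ξ) =
      c • ExteriorAlgebra.ι ℝ ξ := by
  rw [pullScalar_ι, LinearMap.comp_smul, LinearMap.comp_id, map_smul]

/-- The elements satisfying the equation form a submodule `P k`, and `P k` times a covector lies in
`P (k + 1)`; the exterior powers are built by such products. -/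
theorem pullScalar_smul_of_mem (c : ℝ) (k : ℕ) {a : ScalarFiber T}
    (ha : a ∈ ⋀[ℝ]^k (Module.Dual ℝ T)) :
    pullScalar (c • LinearMap.id : T →ₗ[ℝ] T) a = c ^ k • a := by
  let P : ℕ → Submodule ℝ (ScalarFiber T) := fun k =>
    LinearMap.ker ((pullScalar (c • LinearMap.id : T →ₗ[ℝ] T)).toLinearMap - c ^ k • LinearMap.id)
  have hP : ∀ k (a : ScalarFiber T), a ∈ P k ↔
      pullScalar (c • LinearMap.id : T →ₗ[ℝ] T) a = c ^ k • a := by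
    intro k a
    simp [P, sub_eq_zero]
  suffices h : (⋀[ℝ]^k (Module.Dual ℝ T) : Submodule ℝ (ScalarFiber T)) ≤ P k from
    (hP k a).1 (h ha)
  clear ha
  induction k with
  | zero =>
    rw [ExteriorAlgebra.exteriorPower, pow_zero]
    intro a ha
    obtain ⟨r, rfl⟩ := Submodule.mem_one.1 ha
    rw [hP]
    simp
  | succ k ih =>
    rw [ExteriorAlgebra.exteriorPower, pow_succ]
    refine Submodule.mul_le.2 fun a ha b hb => ?_
    obtain ⟨ξ, rfl⟩ := hb
    rw [hP, map_mul, (hP k a).1 (ih ha), pullScalar_smul_ι, smul_mul_smul_comm, pow_succ]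

theorem scaleEnd_of_mem_fiberDegree (c : ℝ) {k : ℕ} {v : EndFiber T E}
    (hv : v ∈ fiberDegree T E k) : scaleEnd T E c v = c ^ k • v := by
  obtain ⟨w, rfl⟩ := hv
  induction w using TensorProduct.induction_on with
  | zero => simp
  | tmul a ψ =>
    rw [LinearMap.rTensor_tmul, scaleEnd_tmul, Submodule.subtype_apply,
      pullScalar_smul_of_mem c k a.2, TensorProduct.smul_tmul']
  | add v w hv hw => simp only [map_add, hv, hw, smul_add]

theorem scaleEnd_neg_one_of_mem_fiberOdd {v : EndFiber T E} (hv : v ∈ fiberOdd T E) :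
    scaleEnd T E (-1) v = -v := by
  have h : fiberOdd T E ≤ LinearMap.ker ((scaleEnd T E (-1)).toLinearMap + LinearMap.id) := by
    refine iSup_le fun j v hv => ?_
    have h1 : scaleEnd T E (-1) v = -v := by
      rw [scaleEnd_of_mem_fiberDegree E (-1) hv, Odd.neg_one_pow ⟨j, rfl⟩]
      exact neg_one_smul ℝ v
    simp [h1]
  simpa [add_eq_zero_iff_eq_neg] using h hv

/-- The scalar one-form `ξ` as an `End E`-valued form. -/
def oneForm (ξ : Module.Dual ℝ T) : EndFiber T E :=
  ExteriorAlgebra.ι ℝ ξ ⊗ₜ[ℝ] 1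

theorem pullEnd_oneForm (A : S →ₗ[ℝ] T) (ξ : Module.Dual ℝ T) :
    pullEnd E A (oneForm E ξ) = oneForm E (ξ ∘ₗ A) := by
  rw [oneForm, pullEnd_tmul, pullScalar_ι, oneForm]

theorem scaleEnd_oneForm (c : ℝ) (ξ : Module.Dual ℝ T) :
    scaleEnd T E c (oneForm E ξ) = c • oneForm E ξ := by
  rw [oneForm, scaleEnd_tmul, pullScalar_smul_ι, TensorProduct.smul_tmul']

/-- Both sides are compatible with products in `a`, so the sign only has to be checked on a
covector, where it is `ξ ∧ η = -η ∧ ξ`. -/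
theorem ι_mul (ξ : Module.Dual ℝ T) (a : ScalarFiber T) :
    ExteriorAlgebra.ι ℝ ξ * a =
      pullScalar ((-1 : ℝ) • LinearMap.id) a * ExteriorAlgebra.ι ℝ ξ := by
  induction a using ExteriorAlgebra.induction with
  | algebraMap r => simp [Algebra.commutes]
  | ι η =>
    rw [pullScalar_smul_ι, neg_one_smul, neg_mul]
    exact eq_neg_of_add_eq_zero_left (ExteriorAlgebra.ι_add_mul_swap ξ η)
  | mul a b ha hb => rw [← mul_assoc, ha, mul_assoc, hb, map_mul, mul_assoc]
  | add a b ha hb => rw [mul_add, ha, hb, map_add, add_mul]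

theorem oneForm_mul (ξ : Module.Dual ℝ T) (v : EndFiber T E) :
    oneForm E ξ * v = scaleEnd T E (-1) v * oneForm E ξ := by
  induction v using TensorProduct.induction_on with
  | zero => simp
  | tmul a ψ =>
    rw [oneForm, scaleEnd_tmul, Algebra.TensorProduct.tmul_mul_tmul,
      Algebra.TensorProduct.tmul_mul_tmul, ι_mul, one_mul, mul_one]
  | add v w hv hw => simp only [mul_add, map_add, add_mul, hv, hw]

theorem oneForm_add (ξ η : Module.Dual ℝ T) :
    oneForm E (ξ + η) = oneForm E ξ + oneForm E η := by
  rw [oneForm, map_add, TensorProduct.add_tmul]; rfl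

theorem oneForm_smul (c : ℝ) (ξ : Module.Dual ℝ T) :
    oneForm E (c • ξ) = c • oneForm E ξ := by
  rw [oneForm, map_smul, ← TensorProduct.smul_tmul']; rfl

theorem oneForm_mul_add_swap (ξ η : Module.Dual ℝ T) :
    oneForm E ξ * oneForm E η + oneForm E η * oneForm E ξ = 0 := by
  rw [oneForm, oneForm, Algebra.TensorProduct.tmul_mul_tmul, Algebra.TensorProduct.tmul_mul_tmul,
    ← TensorProduct.add_tmul, ExteriorAlgebra.ι_add_mul_swap, TensorProduct.zero_tmul]

/-- Graded commutativity of the exterior algebra: each element is the sum of an even one, which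
is central, and an odd one. -/
theorem exists_even_add_odd (a : ScalarFiber T) :
    ∃ a₀ a₁ : ScalarFiber T, a = a₀ + a₁ ∧
      pullScalar ((-1 : ℝ) • LinearMap.id) a₀ = a₀ ∧
      pullScalar ((-1 : ℝ) • LinearMap.id) a₁ = -a₁ ∧
      (∀ b, a₀ * b = b * a₀) ∧ ∀ b, a₁ * b = pullScalar ((-1 : ℝ) • LinearMap.id) b * a₁ := by
  induction a using ExteriorAlgebra.induction with
  | algebraMap r =>
    exact ⟨algebraMap ℝ _ r, 0, by simp, by simp, by simp, Algebra.commutes r, by simp⟩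
  | ι ξ =>
    exact ⟨0, ExteriorAlgebra.ι ℝ ξ, by simp, by simp, by rw [pullScalar_smul_ι, neg_one_smul],
      by simp, ι_mul ξ⟩
  | mul a b ha hb =>
    obtain ⟨a₀, a₁, rfl, h0, h1, c0, c1⟩ := ha
    obtain ⟨b₀, b₁, rfl, k0, k1, d0, d1⟩ := hb
    refine ⟨a₀ * b₀ + a₁ * b₁, a₀ * b₁ + a₁ * b₀, by noncomm_ring, by simp only [map_add, map_mul, h0, h1, k0, k1, neg_mul_neg],
      by simp only [map_add, map_mul, h0, h1, k0, k1, neg_mul, mul_neg, neg_add], fun b => ?_, fun b => ?_⟩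
    · have e1 : a₀ * b₀ * b = b * (a₀ * b₀) := by
        rw [mul_assoc, d0, ← mul_assoc, c0, mul_assoc]
      have e2 : a₁ * b₁ * b = b * (a₁ * b₁) := by
        rw [mul_assoc, d1, ← mul_assoc, c1, ← pullScalar_comp, mul_assoc]
        congr 1
        have : ((-1 : ℝ) • (LinearMap.id : T →ₗ[ℝ] T)) ∘ₗ ((-1 : ℝ) • LinearMap.id) =
          LinearMap.id := by ext; simp
        rw [this, pullScalar_id]
      rw [add_mul, e1, e2, mul_add]
    · have e1 : a₀ * b₁ * b = pullScalar ((-1 : ℝ) • LinearMap.id) b * (a₀ * b₁) := by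
        rw [mul_assoc, d1, ← mul_assoc, c0, mul_assoc]
      have e2 : a₁ * b₀ * b = pullScalar ((-1 : ℝ) • LinearMap.id) b * (a₁ * b₀) := by
        rw [mul_assoc, d0, ← mul_assoc, c1, mul_assoc]
      rw [add_mul, e1, e2, mul_add]
  | add a b ha hb =>
    obtain ⟨a₀, a₁, rfl, h0, h1, c0, c1⟩ := ha
    obtain ⟨b₀, b₁, rfl, k0, k1, d0, d1⟩ := hb
    exact ⟨a₀ + b₀, a₁ + b₁, by abel, by rw [map_add, h0, k0], by rw [map_add, h1, k1, neg_add],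
      fun b => by rw [add_mul, c0, d0, mul_add], fun b => by rw [add_mul, c1, d1, mul_add]⟩

end FibreAlgebra

/-! ### The coefficient of the volume form -/

section TopCoefficient

variable (n : ℕ)

theorem dxI_eq (I : Finset (Fin n)) :
    ∃ v : Fin I.card → Module.Dual ℝ (Coord n), dxI n I = ExteriorAlgebra.ιMulti ℝ I.card v :=
  ⟨_, ExteriorAlgebra.basis_apply _ _⟩

theorem dxI_mem (I : Finset (Fin n)) :
    dxI n I ∈ (⋀[ℝ]^(I.card) (Module.Dual ℝ (Coord n)) : Submodule ℝ (ScalarFiber (Coord n))) := by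
  obtain ⟨v, hv⟩ := dxI_eq n I
  rw [hv]
  exact ExteriorAlgebra.ιMulti_range ℝ _ ⟨v, rfl⟩

theorem dxI_coord_pullScalar_smul (c : ℝ) (I : Finset (Fin n)) (a : ScalarFiber (Coord n)) :
    (dxI n).coord I (pullScalar (c • LinearMap.id) a) = c ^ I.card * (dxI n).coord I a := by
  have : (dxI n).coord I ∘ₗ (pullScalar (c • LinearMap.id : Coord n →ₗ[ℝ] Coord n)).toLinearMap =
      c ^ I.card • (dxI n).coord I := by
    refine (dxI n).ext fun J => ?_
    simp only [LinearMap.comp_apply, AlgHom.toLinearMap_apply,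
      pullScalar_smul_of_mem c _ (dxI_mem n J), map_smul, LinearMap.smul_apply,
      Module.Basis.coord_apply, Module.Basis.repr_self, smul_eq_mul]
    by_cases h : J = I
    · rw [h]
    · simp [h]
  exact LinearMap.congr_fun this a

theorem dxI_coord_of_mem {k : ℕ} {a : ScalarFiber (Coord n)}
    (ha : a ∈ ⋀[ℝ]^k (Module.Dual ℝ (Coord n))) {I : Finset (Fin n)} (hI : I.card ≠ k) :
    (dxI n).coord I a = 0 := by
  -- The factor `2` separates all degrees because `k ↦ 2 ^ k` is injective; the involution, with
  -- factor `-1`, sees only parity.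
  have h := dxI_coord_pullScalar_smul n 2 I a
  rw [pullScalar_smul_of_mem 2 k ha, map_smul, smul_eq_mul, mul_eq_mul_right_iff] at h
  refine h.resolve_left fun h => hI ?_
  exact (pow_right_injective₀ (by norm_num) (by norm_num) h).symm

/-- On products of `n` covectors the top coefficient is an alternating `n`-linear map, hence a
multiple of the determinant. In other degrees both sides vanish. -/
theorem dxI_coord_univ_pullScalar (A : Coord n →ₗ[ℝ] Coord n) (a : ScalarFiber (Coord n)) :
    (dxI n).coord Finset.univ (pullScalar A a) =
      LinearMap.det A * (dxI n).coord Finset.univ a := by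
  have : (dxI n).coord Finset.univ ∘ₗ (pullScalar A).toLinearMap =
      LinearMap.det A • (dxI n).coord Finset.univ := by
    refine (dxI n).ext fun J => ?_
    simp only [LinearMap.comp_apply, AlgHom.toLinearMap_apply, LinearMap.smul_apply, smul_eq_mul]
    obtain ⟨v, hv⟩ := dxI_eq n J
    have hp : pullScalar A (dxI n J) = ExteriorAlgebra.ιMulti ℝ J.card (A.dualMap ∘ v) := by
      rw [hv, pullScalar, ExteriorAlgebra.map_apply_ιMulti]
    by_cases hJ : J.card = n
    · obtain rfl : J = Finset.univ := Finset.eq_univ_of_card J (by simpa using hJ)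
      rw [hp, hv]
      -- The cardinality of `Finset.univ` is `n` only propositionally; as a variable `m` it can be
      -- substituted for `n`.
      generalize Finset.card (Finset.univ : Finset (Fin n)) = m at v hJ
      subst hJ
      set f := ((dxI m).coord Finset.univ).compAlternatingMap (ExteriorAlgebra.ιMulti ℝ m)
      change f (A.dualMap ∘ v) = LinearMap.det A * f v
      rw [f.eq_smul_basis_det (dx m), AlternatingMap.smul_apply, AlternatingMap.smul_apply,
        Module.Basis.det_comp, LinearMap.det_dualMap, smul_eq_mul, smul_eq_mul]
      ring
    · rw [dxI_coord_of_mem n (dxI_mem n J) (by simpa using Ne.symm hJ), hp,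
        dxI_coord_of_mem n (ExteriorAlgebra.ιMulti_range ℝ _ ⟨_, rfl⟩) (by simpa using Ne.symm hJ),
        mul_zero]
  exact LinearMap.congr_fun this a

/-- The involution acts by `-1` on the top coefficient as `n` is odd. The even part of `a` is
central. Applied to `b a₁` with `a₁` odd, the involution shows that the sign incurred in moving `a₁`
past `b` has no effect on the top coefficient. -/
theorem dxI_coord_univ_mul_comm (hn : Odd n) (a b : ScalarFiber (Coord n)) :
    (dxI n).coord Finset.univ (a * b) = (dxI n).coord Finset.univ (b * a) := by
  have hodd : ∀ a, (dxI n).coord Finset.univ (pullScalar ((-1 : ℝ) • LinearMap.id) a) =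
      -(dxI n).coord Finset.univ a := by
    intro a
    rw [dxI_coord_pullScalar_smul, Finset.card_univ, Fintype.card_fin, hn.neg_one_pow,
      neg_one_mul]
  obtain ⟨a₀, a₁, rfl, h0, h1, c0, c1⟩ := exists_even_add_odd a
  rw [add_mul, mul_add, c0, c1, map_add, map_add]
  congr 1
  have := hodd (b * a₁)
  rw [map_mul, h1, mul_neg, map_neg] at this
  linarith

/-- The product is zero if the index sets meet and otherwise is plus or minus the monomial of their
union, which is everything only for `I = J`. -/
theorem dxI_coord_univ_compl_mul (J : Finset (Fin n)) :
    ∃ ε : ℝ, ε ≠ 0 ∧ ∀ I, (dxI n).coord Finset.univ (dxI n Jᶜ * dxI n I) =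
      if I = J then ε else 0 := by
  have hmul : ∀ s t : Finset (Fin n), ∀ h : Disjoint s t, ∃ ε : ℤˣ,
      dxI n s * dxI n t = ε • dxI n (s.disjUnion t h) := fun s t h =>
    ⟨_, ExteriorAlgebra.basis_mul_of_disjoint (dx n) (Set.powersetCard.ofCard (s := s) rfl)
      (Set.powersetCard.ofCard (s := t) rfl) h⟩
  obtain ⟨ε, hε⟩ := hmul Jᶜ J disjoint_compl_left
  have hu : Jᶜ.disjUnion J disjoint_compl_left = Finset.univ := by
    ext i; simp [or_comm, Decidable.em]
  refine ⟨((ε : ℤ) : ℝ), by exact_mod_cast ε.ne_zero, fun I => ?_⟩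
  split_ifs with hI
  · subst hI
    rw [hε, hu, Units.smul_def, map_zsmul]
    simp
  · by_cases hd : Disjoint Jᶜ I
    · obtain ⟨ε', hε'⟩ := hmul Jᶜ I hd
      rw [hε', Units.smul_def, map_zsmul, Module.Basis.coord_apply, Module.Basis.repr_self,
        Finsupp.single_eq_of_ne, smul_zero]
      intro h
      apply hI
      ext i
      have h1 : i ∈ Jᶜ ∨ i ∈ I := by
        rw [← Finset.mem_disjUnion (h := hd), ← h]; exact Finset.mem_univ i
      have h2 : i ∈ Jᶜ → i ∉ I := fun h => Finset.disjoint_left.1 hd h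
      simp only [Finset.mem_compl] at h1 h2
      tauto
    · have := ExteriorAlgebra.basis_mul_of_not_disjoint (dx n)
        (Set.powersetCard.ofCard (s := Jᶜ) rfl) (Set.powersetCard.ofCard (s := I) rfl) hd
      change dxI n Jᶜ * dxI n I = 0 at this
      rw [this, map_zero]

variable (E : Type*) [AddCommGroup E] [Module ℝ E]

/-- The coefficient of `dx₁ ∧ ⋯ ∧ dxₙ` of the trace. -/
def topTr : EndFiber (Coord n) E →ₗ[ℝ] ℝ :=
  (dxI n).coord Finset.univ ∘ₗ trFiber (Coord n) E

variable {E}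

theorem topTr_tmul (a : ScalarFiber (Coord n)) (ψ : Module.End ℝ E) :
    topTr n E (a ⊗ₜ[ℝ] ψ) = LinearMap.trace ℝ E ψ * (dxI n).coord Finset.univ a := by
  rw [topTr, LinearMap.comp_apply, trFiber_tmul, map_smul, smul_eq_mul]

theorem topTr_pullEnd (A : Coord n →ₗ[ℝ] Coord n) (v : EndFiber (Coord n) E) :
    topTr n E (pullEnd E A v) = LinearMap.det A * topTr n E v := by
  rw [topTr, LinearMap.comp_apply, trFiber_pullEnd, dxI_coord_univ_pullScalar]; rfl

theorem topTr_mul_comm (hn : Odd n) (v w : EndFiber (Coord n) E) :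
    topTr n E (v * w) = topTr n E (w * v) := by
  induction v using TensorProduct.induction_on with
  | zero => simp
  | add v₁ v₂ h₁ h₂ => rw [add_mul, mul_add, map_add, map_add, h₁, h₂]
  | tmul a ψ =>
    induction w using TensorProduct.induction_on with
    | zero => simp
    | add v₁ v₂ h₁ h₂ => rw [add_mul, mul_add, map_add, map_add, h₁, h₂]
    | tmul b φ =>
      rw [Algebra.TensorProduct.tmul_mul_tmul, Algebra.TensorProduct.tmul_mul_tmul, topTr_tmul,
        topTr_tmul, LinearMap.trace_mul_comm, dxI_coord_univ_mul_comm n hn]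

/-- The coefficient in `End E` of `dx_J`. -/
def coordEnd (J : Finset (Fin n)) : EndFiber (Coord n) E →ₗ[ℝ] Module.End ℝ E :=
  (TensorProduct.lid ℝ (Module.End ℝ E)).toLinearMap ∘ₗ
    LinearMap.rTensor (Module.End ℝ E) ((dxI n).coord J)

theorem coordEnd_tmul (J : Finset (Fin n)) (a : ScalarFiber (Coord n)) (ψ : Module.End ℝ E) :
    coordEnd n J (a ⊗ₜ[ℝ] ψ) = (dxI n).coord J a • ψ := by
  simp [coordEnd]

theorem coordEnd_scaleEnd (c : ℝ) (J : Finset (Fin n)) (v : EndFiber (Coord n) E) :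
    coordEnd n J (scaleEnd (Coord n) E c v) = c ^ J.card • coordEnd n J v := by
  induction v using TensorProduct.induction_on with
  | zero => simp
  | add v₁ v₂ h₁ h₂ => rw [map_add, map_add, map_add, h₁, h₂, smul_add]
  | tmul a ψ =>
    rw [scaleEnd_tmul, coordEnd_tmul, coordEnd_tmul, dxI_coord_pullScalar_smul, smul_smul]

theorem topTr_compl_mul (J : Finset (Fin n)) :
    ∃ ε : ℝ, ε ≠ 0 ∧ ∀ (ψ : Module.End ℝ E) (v : EndFiber (Coord n) E),
      topTr n E ((dxI n Jᶜ ⊗ₜ[ℝ] ψ) * v) = ε * LinearMap.trace ℝ E (ψ * coordEnd n J v) := by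
  obtain ⟨ε, hε, h⟩ := dxI_coord_univ_compl_mul n J
  refine ⟨ε, hε, fun ψ v => ?_⟩
  induction v using TensorProduct.induction_on with
  | zero => simp
  | add v₁ v₂ h₁ h₂ => rw [mul_add, map_add, h₁, h₂, map_add, mul_add, map_add, mul_add]
  | tmul a φ =>
    rw [Algebra.TensorProduct.tmul_mul_tmul, topTr_tmul, coordEnd_tmul, mul_smul_comm, map_smul,
      smul_eq_mul]
    have : (dxI n).coord Finset.univ (dxI n Jᶜ * a) = ε * (dxI n).coord J a := by
      have : (dxI n).coord Finset.univ ∘ₗ LinearMap.mulLeft ℝ (dxI n Jᶜ) =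
          ε • (dxI n).coord J := by
        refine (dxI n).ext fun I => ?_
        simp only [LinearMap.comp_apply, LinearMap.mulLeft_apply, h, LinearMap.smul_apply,
          Module.Basis.coord_apply, Module.Basis.repr_self, smul_eq_mul, Finsupp.single_apply]
        split_ifs <;> simp
      exact LinearMap.congr_fun this a
    rw [this]
    ring

variable [FiniteDimensional ℝ E]

/-- The trace form is nondegenerate: for the rank-one endomorphism `f ⊗ x`, the trace of its product
with `X` is `f (X x)`. -/
theorem eq_zero_of_trace_mul {X : Module.End ℝ E}
    (h : ∀ a, LinearMap.trace ℝ E (Module.finBasis ℝ (Module.End ℝ E) a * X) = 0) : X = 0 := by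
  have h' : ∀ ψ, LinearMap.trace ℝ E (ψ * X) = 0 := by
    intro ψ
    have : LinearMap.trace ℝ E ∘ₗ LinearMap.mulRight ℝ X = 0 :=
      (Module.finBasis ℝ (Module.End ℝ E)).ext fun a => by simpa using h a
    simpa using LinearMap.congr_fun this ψ
  ext x
  refine (Module.forall_dual_apply_eq_zero_iff ℝ (X x)).1 fun f => ?_
  have h1 : X * f.smulRight x = f.smulRight (X x) := by
    ext y; simp
  rw [← LinearMap.trace_smulRight f (X x), ← h1, LinearMap.trace_mul_comm]
  exact h' _

theorem coordBasis_coord (J : Finset (Fin n)) (a : Fin (Module.finrank ℝ (Module.End ℝ E)))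
    (v : EndFiber (Coord n) E) :
    (coordBasis n E).coord (J, a) v =
      (Module.finBasis ℝ (Module.End ℝ E)).coord a (coordEnd n J v) := by
  induction v using TensorProduct.induction_on with
  | zero => simp
  | add v₁ v₂ h₁ h₂ => rw [map_add, map_add, map_add, h₁, h₂]
  | tmul a φ =>
    rw [coordEnd_tmul, map_smul, Module.Basis.coord_apply, coordBasis,
      Module.Basis.tensorProduct_repr_tmul_apply, smul_eq_mul, smul_eq_mul, mul_comm]
    rfl

theorem coordBasis_apply (J : Finset (Fin n)) (a : Fin (Module.finrank ℝ (Module.End ℝ E))) :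
    coordBasis n E (J, a) = dxI n J ⊗ₜ[ℝ] Module.finBasis ℝ (Module.End ℝ E) a :=
  Module.Basis.tensorProduct_apply _ _ _ _

theorem eq_zero_of_coordEnd {v : EndFiber (Coord n) E} (h : ∀ J, coordEnd n J v = 0) : v = 0 := by
  refine (coordBasis n E).ext_elem fun p => ?_
  have := coordBasis_coord n p.1 p.2 v
  rw [h, map_zero] at this
  simpa using this

/-- The pairing `(v, w) ↦ ∫ Tr(v w)` on a fibre is nondegenerate. -/
theorem eq_zero_of_topTr_mul {v : EndFiber (Coord n) E}
    (h : ∀ p, topTr n E (coordBasis n E p * v) = 0) : v = 0 := by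
  refine eq_zero_of_coordEnd n fun J => eq_zero_of_trace_mul fun a => ?_
  obtain ⟨ε, hε, hJ⟩ := topTr_compl_mul (E := E) n J
  have := h (Jᶜ, a)
  rw [coordBasis_apply, hJ] at this
  exact (mul_eq_zero.1 this).resolve_left hε

/-- Forms of degree `n - 1` are separated by their pairing with one-forms. -/
theorem eq_zero_of_topTr_mul_of_degree {k : ℕ} {v : EndFiber (Coord (k + 1)) E}
    (hv : scaleEnd (Coord (k + 1)) E 2 v = (2 : ℝ) ^ k • v)
    (h : ∀ I a, I.card = 1 → topTr (k + 1) E (coordBasis (k + 1) E (I, a) * v) = 0) : v = 0 := by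
  refine eq_zero_of_coordEnd _ fun J => ?_
  by_cases hJ : J.card = k
  · refine eq_zero_of_trace_mul fun a => ?_
    obtain ⟨ε, hε, hJ'⟩ := topTr_compl_mul (E := E) (k + 1) J
    have := h Jᶜ a (by rw [Finset.card_compl, hJ, Fintype.card_fin]; omega)
    rw [coordBasis_apply, hJ'] at this
    exact (mul_eq_zero.1 this).resolve_left hε
  -- Components of degree other than `k` vanish since `2 ^ k ≠ 2 ^ J.card`.
  · have h2 := coordEnd_scaleEnd (k + 1) 2 J v
    rw [hv, map_smul] at h2
    have h3 : ((2 : ℝ) ^ k - 2 ^ J.card) • coordEnd (k + 1) J v = 0 := by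
      rw [sub_smul, h2, sub_self]
    refine (smul_eq_zero.1 h3).resolve_left fun h4 => hJ ?_
    exact (pow_right_injective₀ (by norm_num) (by norm_num) (sub_eq_zero.1 h4)).symm

end TopCoefficient

/-! ### Calculus of `End E`-valued forms on `ℝⁿ` -/

section CoordinateCalculus

variable {n : ℕ} {E : Type*} [AddCommGroup E] [Module ℝ E] [FiniteDimensional ℝ E]

/-- The sup norm of the coefficients. -/
instance endFiberNormedAddCommGroup : NormedAddCommGroup (EndFiber (Coord n) E) :=
  NormedAddCommGroup.induced _ _ (coordBasis n E).equivFun (coordBasis n E).equivFun.injective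

instance endFiberNormedSpace : NormedSpace ℝ (EndFiber (Coord n) E) :=
  NormedSpace.induced ℝ _ _ (coordBasis n E).equivFun

instance endFiberFiniteDimensional : FiniteDimensional ℝ (EndFiber (Coord n) E) :=
  (coordBasis n E).finiteDimensional_of_finite

variable (n E) in
/-- The product as a continuous bilinear map. -/
def mulCLM : EndFiber (Coord n) E →L[ℝ] EndFiber (Coord n) E →L[ℝ] EndFiber (Coord n) E :=
  (LinearMap.mul ℝ (EndFiber (Coord n) E)).toContinuousBilinearMap

theorem contDiff_linearMap {F G : Type*} [NormedAddCommGroup F] [NormedSpace ℝ F]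
    [FiniteDimensional ℝ F] [NormedAddCommGroup G] [NormedSpace ℝ G] (L : F →ₗ[ℝ] G) :
    ContDiff ℝ ∞ L :=
  (LinearMap.toContinuousLinearMap L).contDiff

theorem fderiv_linearMap_comp {F G H : Type*} [NormedAddCommGroup F] [NormedSpace ℝ F]
    [FiniteDimensional ℝ F] [NormedAddCommGroup G] [NormedSpace ℝ G] [NormedAddCommGroup H]
    [NormedSpace ℝ H] (L : F →ₗ[ℝ] G) {f : H → F} {y : H} (hf : DifferentiableAt ℝ f y) (v : H) :
    fderiv ℝ (fun z => L (f z)) y v = L (fderiv ℝ f y v) := by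
  have := ((LinearMap.toContinuousLinearMap L).hasFDerivAt.comp y hf.hasFDerivAt).fderiv
  change fderiv ℝ ((LinearMap.toContinuousLinearMap L) ∘ f) y v = _
  rw [this]
  rfl

theorem sum_coord_smul (v : EndFiber (Coord n) E) :
    ∑ p, (coordBasis n E).coord p v • coordBasis n E p = v :=
  (coordBasis n E).sum_repr v

theorem smoothOnCoord_iff {f : Coord n → EndFiber (Coord n) E} {s : Set (Coord n)} :
    SmoothOnCoord f s ↔ ContDiffOn ℝ ∞ f s := by
  refine ⟨fun h => ?_, fun h p => (contDiff_linearMap _).comp_contDiffOn h⟩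
  have : f = fun z => ∑ p, (coordBasis n E).coord p (f z) • coordBasis n E p :=
    funext fun z => (sum_coord_smul _).symm
  rw [this]
  exact ContDiffOn.sum fun p _ => (h p).smul contDiffOn_const

theorem contDiffOn_mul {f g : Coord n → EndFiber (Coord n) E} {s : Set (Coord n)}
    (hf : ContDiffOn ℝ ∞ f s) (hg : ContDiffOn ℝ ∞ g s) :
    ContDiffOn ℝ ∞ (fun z => f z * g z) s :=
  ((mulCLM n E).contDiff.comp_contDiffOn hf).clm_apply hg

theorem dual_eq_sum (ξ : Module.Dual ℝ (Coord n)) :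
    ξ = ∑ i, ξ (EuclideanSpace.single i 1) • dx n i := by
  have := (EuclideanSpace.basisFun (Fin n) ℝ).toBasis.sum_dual_apply_smul_coord ξ
  rw [← this]
  simp [dx]

variable (n E) in
/-- The one-form `dxᵢ`. -/
def dxEnd (i : Fin n) : EndFiber (Coord n) E := oneForm E (dx n i)

theorem sum_dxEnd_mul {E : Type*} [AddCommGroup E] [Module ℝ E] (ξ : Module.Dual ℝ (Coord n)) (w : EndFiber (Coord n) E) :
    ∑ i, dxEnd n E i * (ξ (EuclideanSpace.single i 1) • w) = oneForm E ξ * w := by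
  conv_rhs => rw [dual_eq_sum ξ]
  have : oneForm E (∑ i, ξ (EuclideanSpace.single i 1) • dx n i) =
      ∑ i, ξ (EuclideanSpace.single i 1) • oneForm E (dx n i) := by
    simp only [oneForm, map_sum, map_smul, TensorProduct.sum_tmul, TensorProduct.smul_tmul']
  rw [this, Finset.sum_mul]
  exact Finset.sum_congr rfl fun i _ => by
    rw [smul_mul_assoc, ← mul_smul_comm]; rfl

/-- The form `d = ∑ dxᵢ ∧ ∂ᵢ` no longer mentions the basis of the fibre, so the rules of calculus
apply to form-valued functions directly. -/
theorem extDerivCoord_eq {f : Coord n → EndFiber (Coord n) E} {y : Coord n}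
    (hf : DifferentiableAt ℝ f y) :
    extDerivCoord f y = ∑ i, dxEnd n E i * fderiv ℝ f y (EuclideanSpace.single i 1) := by
  refine Finset.sum_congr rfl fun i _ => ?_
  conv_rhs => rw [← sum_coord_smul (fderiv ℝ f y (EuclideanSpace.single i 1)), Finset.mul_sum]
  refine Finset.sum_congr rfl fun p _ => ?_
  rw [fderiv_linearMap_comp _ hf, mul_smul_comm]
  rfl

theorem extDerivCoord_congr {f g : Coord n → EndFiber (Coord n) E} {y : Coord n}
    (h : f =ᶠ[nhds y] g) : extDerivCoord f y = extDerivCoord g y := by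
  refine Finset.sum_congr rfl fun i _ => Finset.sum_congr rfl fun p _ => ?_
  have : (fun z => (coordBasis n E).coord p (f z)) =ᶠ[nhds y]
      fun z => (coordBasis n E).coord p (g z) := h.fun_comp _
  rw [this.fderiv_eq]

theorem extDerivCoord_const (v : EndFiber (Coord n) E) (y : Coord n) :
    extDerivCoord (fun _ => v) y = 0 := by
  simp [extDerivCoord]

/-- The sign comes from moving `dxᵢ` to the right past `f`. -/
theorem extDerivCoord_mul {f g : Coord n → EndFiber (Coord n) E} {y : Coord n}
    (hf : DifferentiableAt ℝ f y) (hg : DifferentiableAt ℝ g y) :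
    extDerivCoord (fun z => f z * g z) y =
      extDerivCoord f y * g y + scaleEnd (Coord n) E (-1) (f y) * extDerivCoord g y := by
  have h := (mulCLM n E).hasFDerivAt_of_bilinear hf.hasFDerivAt hg.hasFDerivAt
  rw [extDerivCoord_eq hf, extDerivCoord_eq hg, extDerivCoord_eq (f := fun z => f z * g z)
    h.differentiableAt, Finset.sum_mul, Finset.mul_sum, ← Finset.sum_add_distrib]
  refine Finset.sum_congr rfl fun i _ => ?_
  have : fderiv ℝ (fun z => f z * g z) y (EuclideanSpace.single i 1) =
      f y * fderiv ℝ g y (EuclideanSpace.single i 1) +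
        fderiv ℝ f y (EuclideanSpace.single i 1) * g y := by
    change fderiv ℝ (fun z => mulCLM n E (f z) (g z)) y _ = _
    rw [h.fderiv]
    rfl
  rw [this, mul_add, ← mul_assoc, ← mul_assoc, dxEnd, oneForm_mul, mul_assoc, mul_assoc, add_comm]

theorem extDerivCoord_add {f g : Coord n → EndFiber (Coord n) E} {y : Coord n}
    (hf : DifferentiableAt ℝ f y) (hg : DifferentiableAt ℝ g y) :
    extDerivCoord (fun z => f z + g z) y = extDerivCoord f y + extDerivCoord g y := by
  rw [extDerivCoord_eq hf, extDerivCoord_eq hg, extDerivCoord_eq (hf.fun_add hg),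
    ← Finset.sum_add_distrib]
  exact Finset.sum_congr rfl fun i _ => by rw [fderiv_fun_add hf hg, ← mul_add]; rfl

theorem extDerivCoord_smul {r : Coord n → ℝ} {g : Coord n → EndFiber (Coord n) E} {y : Coord n}
    (hr : DifferentiableAt ℝ r y) (hg : DifferentiableAt ℝ g y) :
    extDerivCoord (fun z => r z • g z) y =
      oneForm E (fderiv ℝ r y : Coord n →ₗ[ℝ] ℝ) * g y + r y • extDerivCoord g y := by
  rw [extDerivCoord_eq hg, extDerivCoord_eq (hr.fun_smul hg), ← sum_dxEnd_mul, Finset.smul_sum,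
    ← Finset.sum_add_distrib]
  refine Finset.sum_congr rfl fun i _ => ?_
  have : fderiv ℝ (fun z => r z • g z) y (EuclideanSpace.single i 1) =
      fderiv ℝ r y (EuclideanSpace.single i 1) • g y +
        r y • fderiv ℝ g y (EuclideanSpace.single i 1) := by
    rw [fderiv_fun_smul hr hg, add_comm]
    rfl
  rw [this, mul_add, mul_smul_comm (r y)]
  rfl

theorem scaleEnd_extDerivCoord {f : Coord n → EndFiber (Coord n) E} {y : Coord n}
    (hf : DifferentiableAt ℝ f y) (c : ℝ) :
    scaleEnd (Coord n) E c (extDerivCoord f y) =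
      c • extDerivCoord (fun z => scaleEnd (Coord n) E c (f z)) y := by
  have hs : DifferentiableAt ℝ (fun z => scaleEnd (Coord n) E c (f z)) y :=
    ((contDiff_linearMap (scaleEnd (Coord n) E c).toLinearMap).differentiable
      (by simp)).differentiableAt.comp y hf
  rw [extDerivCoord_eq hf, extDerivCoord_eq hs, map_sum, Finset.smul_sum]
  refine Finset.sum_congr rfl fun i _ => ?_
  have := fderiv_linearMap_comp (scaleEnd (Coord n) E c).toLinearMap hf
    (EuclideanSpace.single i 1)
  simp only [AlgHom.toLinearMap_apply] at this
  rw [this, map_mul, dxEnd, scaleEnd_oneForm]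
  exact smul_mul_assoc _ _ _

/-- Exchanging `i` and `j` changes the sign of `dxᵢ ∧ dxⱼ` and fixes `w`, so the sum is its own
negative. This is behind both `d ∘ d = 0` and the closedness of pulled-back constant forms. -/
theorem sum_symm_eq_zero {E : Type*} [AddCommGroup E] [Module ℝ E] (w : Fin n → Fin n → EndFiber (Coord n) E) (hw : ∀ i j, w i j = w j i) :
    ∑ i, ∑ j, dxEnd n E i * (dxEnd n E j * w i j) = 0 := by
  set X := ∑ i, ∑ j, dxEnd n E i * (dxEnd n E j * w i j) with hX
  have h1 : X = ∑ i, ∑ j, dxEnd n E j * (dxEnd n E i * w i j) := by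
    rw [hX, Finset.sum_comm]
    exact Finset.sum_congr rfl fun i _ => Finset.sum_congr rfl fun j _ => by rw [hw]
  have h2 : X + X = 0 := by
    nth_rewrite 1 [hX]
    rw [h1, ← Finset.sum_add_distrib]
    refine Finset.sum_eq_zero fun i _ => ?_
    rw [← Finset.sum_add_distrib]
    refine Finset.sum_eq_zero fun j _ => ?_
    rw [← mul_assoc, ← mul_assoc, ← add_mul, dxEnd, dxEnd, oneForm_mul_add_swap, zero_mul]
  have h3 : (2 : ℝ) • X = 0 := by rw [two_smul, h2]
  exact (smul_eq_zero.1 h3).resolve_left two_ne_zero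

theorem contDiffOn_fderiv {F G : Type*} [NormedAddCommGroup F] [NormedSpace ℝ F]
    [NormedAddCommGroup G] [NormedSpace ℝ G] {f : F → G} {U : Set F} (hU : IsOpen U)
    (hf : ContDiffOn ℝ ∞ f U) : ContDiffOn ℝ ∞ (fderiv ℝ f) U :=
  hf.fderiv_of_isOpen hU (by simp)

theorem differentiableAt_of_contDiffOn {F G : Type*} [NormedAddCommGroup F] [NormedSpace ℝ F]
    [NormedAddCommGroup G] [NormedSpace ℝ G] {f : F → G} {U : Set F} (hU : IsOpen U)
    (hf : ContDiffOn ℝ ∞ f U) {y : F} (hy : y ∈ U) : DifferentiableAt ℝ f y :=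
  (hf.contDiffAt (hU.mem_nhds hy)).differentiableAt (by simp)

theorem isSymmSndFDerivAt_of_contDiffOn {F G : Type*} [NormedAddCommGroup F] [NormedSpace ℝ F]
    [NormedAddCommGroup G] [NormedSpace ℝ G] {f : F → G} {U : Set F} (hU : IsOpen U)
    (hf : ContDiffOn ℝ ∞ f U) {y : F} (hy : y ∈ U) : IsSymmSndFDerivAt ℝ f y := by
  refine (hf.contDiffAt (hU.mem_nhds hy)).isSymmSndFDerivAt ?_
  rw [minSmoothness_of_isRCLikeNormedField]
  exact WithTop.coe_le_coe.2 le_top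

theorem contDiffOn_extDerivCoord {f : Coord n → EndFiber (Coord n) E} {U : Set (Coord n)}
    (hU : IsOpen U) (hf : ContDiffOn ℝ ∞ f U) : ContDiffOn ℝ ∞ (extDerivCoord f) U := by
  have h : ∀ y ∈ U, extDerivCoord f y =
      ∑ i, dxEnd n E i * fderiv ℝ f y (EuclideanSpace.single i 1) := fun y hy =>
    extDerivCoord_eq (differentiableAt_of_contDiffOn hU hf hy)
  refine ContDiffOn.congr ?_ h
  exact ContDiffOn.sum fun i _ => contDiffOn_mul contDiffOn_const
    ((contDiffOn_fderiv hU hf).clm_apply contDiffOn_const)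

theorem extDerivCoord_extDerivCoord {f : Coord n → EndFiber (Coord n) E} {U : Set (Coord n)}
    (hU : IsOpen U) (hf : ContDiffOn ℝ ∞ f U) {y : Coord n} (hy : y ∈ U) :
    extDerivCoord (extDerivCoord f) y = 0 := by
  have hd := differentiableAt_of_contDiffOn hU (contDiffOn_fderiv hU hf) hy
  have hsymm : IsSymmSndFDerivAt ℝ f y :=
    isSymmSndFDerivAt_of_contDiffOn hU hf hy
  rw [extDerivCoord_eq (differentiableAt_of_contDiffOn hU (contDiffOn_extDerivCoord hU hf) hy)]
  have h : extDerivCoord f =ᶠ[nhds y]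
      fun z => ∑ i, mulCLM n E (dxEnd n E i) (fderiv ℝ f z (EuclideanSpace.single i 1)) := by
    filter_upwards [hU.mem_nhds hy] with z hz
    exact extDerivCoord_eq (differentiableAt_of_contDiffOn hU hf hz)
  have h2 : ∀ j, fderiv ℝ (extDerivCoord f) y (EuclideanSpace.single j 1) =
      ∑ i, dxEnd n E i * fderiv ℝ (fderiv ℝ f) y (EuclideanSpace.single j 1)
        (EuclideanSpace.single i 1) := by
    intro j
    have h3 : HasFDerivAt (fun z => ∑ i, mulCLM n E (dxEnd n E i)
        (fderiv ℝ f z (EuclideanSpace.single i 1))) (∑ i, (mulCLM n E (dxEnd n E i)).comp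
          ((fderiv ℝ (fderiv ℝ f) y).flip (EuclideanSpace.single i 1))) y :=
      HasFDerivAt.fun_sum fun i _ => (mulCLM n E (dxEnd n E i)).hasFDerivAt.comp y
        (hd.hasFDerivAt.clm_apply (hasFDerivAt_const _ _) |>.congr_fderiv (by ext; simp))
    rw [h.fderiv_eq, h3.fderiv, sum_apply]
    rfl
  simp only [h2, Finset.mul_sum]
  exact sum_symm_eq_zero _ fun i j => hsymm _ _

end CoordinateCalculus

/-! ### Pull-back along a smooth map of `ℝⁿ` -/

section PullBack

variable {n : ℕ} {E : Type*} [AddCommGroup E] [Module ℝ E]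

/-- The pull-back of a form on `ℝⁿ`. -/
def pullAlong (φ : Coord n → Coord n) (f : Coord n → EndFiber (Coord n) E) (z : Coord n) :
    EndFiber (Coord n) E :=
  pullEnd E (fderiv ℝ φ z).toLinearMap (f (φ z))

variable [FiniteDimensional ℝ E] {φ : Coord n → Coord n} {U : Set (Coord n)}

/-- The pull-back of a constant covector is `∑ ξ(∂ᵢφ) dxᵢ`; its exterior derivative has the
coefficients `ξ(∂ᵢ∂ⱼφ)`, symmetric in `i` and `j`. -/
theorem oneForm_comp_fderiv_props (hU : IsOpen U) (hφ : ContDiffOn ℝ ∞ φ U)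
    (ξ : Module.Dual ℝ (Coord n)) :
    ContDiffOn ℝ ∞ (fun z => oneForm E (ξ ∘ₗ (fderiv ℝ φ z).toLinearMap)) U ∧
    ∀ y ∈ U, extDerivCoord (fun z => oneForm E (ξ ∘ₗ (fderiv ℝ φ z).toLinearMap)) y = 0 := by
  have hDφ := contDiffOn_fderiv hU hφ
  have hsum : ∀ B : Coord n →L[ℝ] Coord n, oneForm E (ξ ∘ₗ B.toLinearMap) =
      ∑ i, dxEnd n E i * ((ξ (B (EuclideanSpace.single i 1))) • 1) := by
    intro B
    have := sum_dxEnd_mul (E := E) (ξ ∘ₗ B.toLinearMap) 1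
    rw [mul_one] at this
    rw [← this]
    rfl
  have hcoef : ∀ i, ContDiffOn ℝ ∞
      (fun z => ξ (fderiv ℝ φ z (EuclideanSpace.single i 1))) U := fun i =>
    (contDiff_linearMap ξ).comp_contDiffOn (hDφ.clm_apply contDiffOn_const)
  have hsm : ContDiffOn ℝ ∞ (fun z => oneForm E (ξ ∘ₗ (fderiv ℝ φ z).toLinearMap)) U := by
    simp only [hsum]
    exact ContDiffOn.sum fun i _ => contDiffOn_mul contDiffOn_const
      ((hcoef i).smul (contDiffOn_const (c := (1 : EndFiber (Coord n) E))))
  refine ⟨hsm, fun y hy => ?_⟩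
  have hd := differentiableAt_of_contDiffOn hU hDφ hy
  have hsymm : IsSymmSndFDerivAt ℝ φ y :=
    isSymmSndFDerivAt_of_contDiffOn hU hφ hy
  rw [extDerivCoord_eq (differentiableAt_of_contDiffOn hU hsm hy)]
  have h2 : ∀ v, fderiv ℝ (fun z => oneForm E (ξ ∘ₗ (fderiv ℝ φ z).toLinearMap)) y v =
      oneForm E (ξ ∘ₗ (fderiv ℝ (fderiv ℝ φ) y v).toLinearMap) := by
    let L : (Coord n →L[ℝ] Coord n) →ₗ[ℝ] EndFiber (Coord n) E :=
      { toFun := fun B => oneForm E (ξ ∘ₗ B.toLinearMap)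
        map_add' := fun A B => by
          rw [← oneForm_add, ← LinearMap.comp_add]; rfl
        map_smul' := fun c B => by
          rw [RingHom.id_apply, ← oneForm_smul, ← LinearMap.comp_smul]; rfl }
    exact fderiv_linearMap_comp L hd
  simp only [h2]
  simp only [hsum, Finset.mul_sum]
  refine sum_symm_eq_zero (fun i j => ξ (fderiv ℝ (fderiv ℝ φ) y (EuclideanSpace.single i 1)
    (EuclideanSpace.single j 1)) • 1) fun i j => ?_
  simp only [hsymm (EuclideanSpace.single i 1)]

/-- Smoothness and closedness pass to products (by Leibniz) and sums, so it is enough to treat the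
generators: scalars, covectors and endomorphisms. -/
theorem pullEnd_fderiv_props (hU : IsOpen U) (hφ : ContDiffOn ℝ ∞ φ U)
    (v : EndFiber (Coord n) E) :
    ContDiffOn ℝ ∞ (fun z => pullEnd E (fderiv ℝ φ z).toLinearMap v) U ∧
    ∀ y ∈ U, extDerivCoord (fun z => pullEnd E (fderiv ℝ φ z).toLinearMap v) y = 0 := by
  have hmul : ∀ v w : EndFiber (Coord n) E,
      (ContDiffOn ℝ ∞ (fun z => pullEnd E (fderiv ℝ φ z).toLinearMap v) U ∧
        ∀ y ∈ U, extDerivCoord (fun z => pullEnd E (fderiv ℝ φ z).toLinearMap v) y = 0) →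
      (ContDiffOn ℝ ∞ (fun z => pullEnd E (fderiv ℝ φ z).toLinearMap w) U ∧
        ∀ y ∈ U, extDerivCoord (fun z => pullEnd E (fderiv ℝ φ z).toLinearMap w) y = 0) →
      ContDiffOn ℝ ∞ (fun z => pullEnd E (fderiv ℝ φ z).toLinearMap (v * w)) U ∧
        ∀ y ∈ U, extDerivCoord (fun z => pullEnd E (fderiv ℝ φ z).toLinearMap (v * w)) y = 0 := by
    intro v w hv hw
    simp only [map_mul]
    refine ⟨contDiffOn_mul hv.1 hw.1, fun y hy => ?_⟩
    rw [extDerivCoord_mul (differentiableAt_of_contDiffOn hU hv.1 hy)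
      (differentiableAt_of_contDiffOn hU hw.1 hy), hv.2 y hy, hw.2 y hy, zero_mul, mul_zero,
      add_zero]
  have hadd : ∀ v w : EndFiber (Coord n) E,
      (ContDiffOn ℝ ∞ (fun z => pullEnd E (fderiv ℝ φ z).toLinearMap v) U ∧
        ∀ y ∈ U, extDerivCoord (fun z => pullEnd E (fderiv ℝ φ z).toLinearMap v) y = 0) →
      (ContDiffOn ℝ ∞ (fun z => pullEnd E (fderiv ℝ φ z).toLinearMap w) U ∧
        ∀ y ∈ U, extDerivCoord (fun z => pullEnd E (fderiv ℝ φ z).toLinearMap w) y = 0) →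
      ContDiffOn ℝ ∞ (fun z => pullEnd E (fderiv ℝ φ z).toLinearMap (v + w)) U ∧
        ∀ y ∈ U, extDerivCoord (fun z => pullEnd E (fderiv ℝ φ z).toLinearMap (v + w)) y = 0 := by
    intro v w hv hw
    simp only [map_add]
    refine ⟨hv.1.add hw.1, fun y hy => ?_⟩
    rw [extDerivCoord_add (differentiableAt_of_contDiffOn hU hv.1 hy)
      (differentiableAt_of_contDiffOn hU hw.1 hy), hv.2 y hy, hw.2 y hy, add_zero]
  induction v using TensorProduct.induction_on with
  | zero => simpa only [map_zero] using ⟨contDiffOn_const, fun y _ => extDerivCoord_const 0 y⟩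
  | add v w hv hw => exact hadd v w hv hw
  | tmul a ψ =>
    have hψ : a ⊗ₜ[ℝ] ψ = (a ⊗ₜ[ℝ] (1 : Module.End ℝ E)) * ((1 : ScalarFiber (Coord n)) ⊗ₜ[ℝ] ψ) := by
      rw [Algebra.TensorProduct.tmul_mul_tmul, mul_one, one_mul]
    rw [hψ]
    refine hmul _ _ ?_ ?_
    · induction a using ExteriorAlgebra.induction with
      | algebraMap r =>
        simp only [pullEnd_tmul, AlgHom.commutes]
        exact ⟨contDiffOn_const, fun y _ => extDerivCoord_const _ y⟩
      | ι ξ =>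
        simp only [pullEnd_tmul, pullScalar_ι]
        exact oneForm_comp_fderiv_props hU hφ ξ
      | mul a b ha hb =>
        have := hmul _ _ (ha (by rw [Algebra.TensorProduct.tmul_mul_tmul, mul_one, one_mul]))
          (hb (by rw [Algebra.TensorProduct.tmul_mul_tmul, mul_one, one_mul]))
        simpa only [Algebra.TensorProduct.tmul_mul_tmul, mul_one] using this
      | add a b ha hb =>
        have := hadd _ _ (ha (by rw [Algebra.TensorProduct.tmul_mul_tmul, mul_one, one_mul]))
          (hb (by rw [Algebra.TensorProduct.tmul_mul_tmul, mul_one, one_mul]))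
        simpa only [TensorProduct.add_tmul] using this
    · simp only [pullEnd_tmul, map_one]
      exact ⟨contDiffOn_const, fun y _ => extDerivCoord_const _ y⟩

/-- Separates the coefficients, to which the chain rule applies, from the pulled-back basis
elements, which are closed. -/
theorem pullAlong_eq_sum (f : Coord n → EndFiber (Coord n) E) :
    pullAlong φ f = fun z => ∑ p, (coordBasis n E).coord p (f (φ z)) •
      pullEnd E (fderiv ℝ φ z).toLinearMap (coordBasis n E p) := by
  funext z
  rw [pullAlong]
  conv_lhs => rw [← sum_coord_smul (f (φ z)), map_sum]
  simp only [map_smul]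

theorem contDiffOn_pullAlong (hU : IsOpen U) (hφ : ContDiffOn ℝ ∞ φ U) {W : Set (Coord n)}
    {f : Coord n → EndFiber (Coord n) E} (hf : ContDiffOn ℝ ∞ f W) (hUW : Set.MapsTo φ U W) :
    ContDiffOn ℝ ∞ (pullAlong φ f) U := by
  rw [pullAlong_eq_sum]
  exact ContDiffOn.sum fun p _ => ContDiffOn.smul
    ((contDiff_linearMap ((coordBasis n E).coord p)).comp_contDiffOn (hf.comp hφ hUW))
    (pullEnd_fderiv_props hU hφ (coordBasis n E p)).1

theorem extDerivCoord_sum {ι : Type*} (s : Finset ι) {f : ι → Coord n → EndFiber (Coord n) E}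
    {y : Coord n} (hf : ∀ i ∈ s, DifferentiableAt ℝ (f i) y) :
    extDerivCoord (fun z => ∑ i ∈ s, f i z) y = ∑ i ∈ s, extDerivCoord (f i) y := by
  classical
  induction s using Finset.induction_on with
  | empty => simpa using extDerivCoord_const (0 : EndFiber (Coord n) E) y
  | insert i s hi ih =>
    simp only [Finset.sum_insert hi]
    rw [extDerivCoord_add (hf i (Finset.mem_insert_self i s))
      (DifferentiableAt.fun_sum fun j hj => hf j (Finset.mem_insert_of_mem hj)),
      ih fun j hj => hf j (Finset.mem_insert_of_mem hj)]

theorem extDerivCoord_eq_sum {f : Coord n → EndFiber (Coord n) E} {y : Coord n}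
    (hf : DifferentiableAt ℝ f y) :
    extDerivCoord f y = ∑ p, oneForm E ((coordBasis n E).coord p ∘ₗ (fderiv ℝ f y).toLinearMap) *
      coordBasis n E p := by
  rw [extDerivCoord, Finset.sum_comm]
  refine Finset.sum_congr rfl fun p _ => ?_
  rw [← sum_dxEnd_mul]
  refine Finset.sum_congr rfl fun i _ => ?_
  rw [fderiv_linearMap_comp _ hf, mul_smul_comm]
  rfl

/-- The exterior derivative commutes with pull-backs. -/
theorem extDerivCoord_pullAlong (hU : IsOpen U) (hφ : ContDiffOn ℝ ∞ φ U)
    {f : Coord n → EndFiber (Coord n) E} {y : Coord n} (hy : y ∈ U)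
    (hf : DifferentiableAt ℝ f (φ y)) :
    extDerivCoord (pullAlong φ f) y = pullAlong φ (extDerivCoord f) y := by
  have hφy := differentiableAt_of_contDiffOn hU hφ hy
  have hc : ∀ p, HasFDerivAt (fun z => (coordBasis n E).coord p (f (φ z)))
      ((LinearMap.toContinuousLinearMap ((coordBasis n E).coord p)).comp
        ((fderiv ℝ f (φ y)).comp (fderiv ℝ φ y))) y := fun p =>
    (LinearMap.toContinuousLinearMap ((coordBasis n E).coord p)).hasFDerivAt.comp y
      (hf.hasFDerivAt.comp y hφy.hasFDerivAt)
  have hp : ∀ p, DifferentiableAt ℝ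
      (fun z => pullEnd E (fderiv ℝ φ z).toLinearMap (coordBasis n E p)) y := fun p =>
    differentiableAt_of_contDiffOn hU (pullEnd_fderiv_props hU hφ _).1 hy
  rw [pullAlong_eq_sum, extDerivCoord_sum _ fun p _ => (hc p).differentiableAt.fun_smul (hp p),
    pullAlong, extDerivCoord_eq_sum hf, map_sum]
  refine Finset.sum_congr rfl fun p _ => ?_
  rw [extDerivCoord_smul (hc p).differentiableAt (hp p), (pullEnd_fderiv_props hU hφ _).2 y hy,
    smul_zero, add_zero, map_mul, pullEnd_oneForm, (hc p).fderiv]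
  rfl

end PullBack

/-! ### Stokes' theorem in `ℝⁿ` -/

section Stokes

open MeasureTheory

variable {n : ℕ} {E : Type*} [AddCommGroup E] [Module ℝ E] [FiniteDimensional ℝ E]

/-- Integration by parts against the constant function `1`. -/
theorem integral_fderiv_apply_eq_zero {F : Type*} [NormedAddCommGroup F] [NormedSpace ℝ F]
    [FiniteDimensional ℝ F] [MeasurableSpace F] [BorelSpace F] (μ : Measure F)
    [μ.IsAddHaarMeasure] {h : F → ℝ} (hh : ContDiff ℝ 1 h) (hc : HasCompactSupport h) (v : F) :
    ∫ x, fderiv ℝ h x v ∂μ = 0 := by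
  have hi : Integrable (fun x => fderiv ℝ h x v) μ :=
    ((hh.continuous_fderiv (by simp)).clm_apply continuous_const).integrable_of_hasCompactSupport
      (hc.fderiv_apply (𝕜 := ℝ) v)
  have := integral_mul_fderiv_eq_neg_fderiv_mul_of_integrable (μ := μ) (f := fun _ : F => (1 : ℝ))
    (g := h) (v := v) (by simp) (by simpa using hi)
    (by simpa using hh.continuous.integrable_of_hasCompactSupport hc)
    (fun x _ => by fun_prop) (fun x _ => (hh.differentiable (by simp)).differentiableAt)
  simpa using this

theorem integral_topTr_extDerivCoord {g : Coord n → EndFiber (Coord n) E} (hg : ContDiff ℝ ∞ g)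
    (hc : HasCompactSupport g) : ∫ y, topTr n E (extDerivCoord g y) = 0 := by
  have hgd : Differentiable ℝ g := hg.differentiable (by simp)
  let L : Fin n → EndFiber (Coord n) E →ₗ[ℝ] ℝ := fun i =>
    topTr n E ∘ₗ LinearMap.mulLeft ℝ (dxEnd n E i)
  have h1 : ∀ y, topTr n E (extDerivCoord g y) =
      ∑ i, fderiv ℝ (fun z => L i (g z)) y (EuclideanSpace.single i 1) := by
    intro y
    rw [extDerivCoord_eq (hgd y), map_sum]
    exact Finset.sum_congr rfl fun i _ => (fderiv_linearMap_comp (L i) (hgd y) _).symm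
  have hL : ∀ i, ContDiff ℝ 1 (fun z => L i (g z)) := fun i =>
    ((contDiff_linearMap (L i)).comp hg).of_le (by exact_mod_cast le_top)
  have hLc : ∀ i, HasCompactSupport (fun z => L i (g z)) := fun i =>
    hc.comp_left (map_zero (L i))
  simp only [h1]
  rw [integral_finsetSum _ fun i _ => ?_]
  · exact Finset.sum_eq_zero fun i _ => integral_fderiv_apply_eq_zero _ (hL i) (hLc i) _
  · exact (((hL i).continuous_fderiv (by simp)).clm_apply
      continuous_const).integrable_of_hasCompactSupport ((hLc i).fderiv_apply (𝕜 := ℝ) _)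

/-- `U` and the complement of `C` are open and cover the space; the extension is `g` on the first
and zero on the second. -/
theorem contDiff_indicator {F G : Type*} [NormedAddCommGroup F] [NormedSpace ℝ F]
    [NormedAddCommGroup G] [NormedSpace ℝ G] {g : F → G} {U C : Set F} (hU : IsOpen U)
    (hC : IsClosed C) (hCU : C ⊆ U) (hg : ContDiffOn ℝ ∞ g U) (h0 : ∀ y ∈ U, y ∉ C → g y = 0) :
    ContDiff ℝ ∞ (U.indicator g) := by
  refine contDiff_iff_contDiffAt.2 fun y => ?_
  by_cases hy : y ∈ U
  · refine (hg.contDiffAt (hU.mem_nhds hy)).congr_of_eventuallyEq ?_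
    filter_upwards [hU.mem_nhds hy] with z hz
    exact Set.indicator_of_mem hz g
  · refine (contDiffAt_const (c := (0 : G))).congr_of_eventuallyEq ?_
    filter_upwards [hC.isOpen_compl.mem_nhds fun h => hy (hCU h)] with z hz
    by_cases hzU : z ∈ U
    · rw [Set.indicator_of_mem hzU, h0 z hzU hz]
    · exact Set.indicator_of_notMem hzU g

theorem setIntegral_topTr_extDerivCoord {g : Coord n → EndFiber (Coord n) E}
    {U C : Set (Coord n)} (hU : IsOpen U) (hC : IsCompact C) (hCU : C ⊆ U)
    (hg : ContDiffOn ℝ ∞ g U) (h0 : ∀ y ∈ U, y ∉ C → g y = 0) :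
    ∫ y in U, topTr n E (extDerivCoord g y) = 0 := by
  have hsupp : ∀ y, y ∉ C → U.indicator g y = 0 := by
    intro y hy
    by_cases hyU : y ∈ U
    · rw [Set.indicator_of_mem hyU, h0 y hyU hy]
    · exact Set.indicator_of_notMem hyU g
  rw [← integral_topTr_extDerivCoord (contDiff_indicator hU hC.isClosed hCU hg h0)
    (HasCompactSupport.intro hC hsupp), ← integral_indicator hU.measurableSet]
  congr 1
  funext y
  by_cases hy : y ∈ U
  · rw [Set.indicator_of_mem hy]
    congr 1
    refine extDerivCoord_congr ?_
    filter_upwards [hU.mem_nhds hy] with z hz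
    exact (Set.indicator_of_mem hz g).symm
  · rw [Set.indicator_of_notMem hy]
    have : U.indicator g =ᶠ[nhds y] fun _ => 0 := by
      filter_upwards [hC.isClosed.isOpen_compl.mem_nhds fun h => hy (hCU h)] with z hz
      exact hsupp z hz
    rw [extDerivCoord_congr this, extDerivCoord_const, map_zero]

end Stokes

/-! ### Smooth forms on a manifold -/

section ManifoldForms

variable {n : ℕ} {M : Type*} [TopologicalSpace M] [ChartedSpace (Coord n) M]
  {E : Type*} [AddCommGroup E] [Module ℝ E]

namespace EndForm

theorem inChart_mul (A B : EndForm n M E) (e : OpenPartialHomeomorph M (Coord n)) (y : Coord n) :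
    (A * B).inChart e y = A.inChart e y * B.inChart e y :=
  map_mul (pullEnd E (mfderiv (𝓡 n) (𝓡 n) e.symm y).toLinearMap) _ _

theorem inChart_add (A B : EndForm n M E) (e : OpenPartialHomeomorph M (Coord n)) (y : Coord n) :
    (A + B).inChart e y = A.inChart e y + B.inChart e y :=
  map_add (pullEnd E (mfderiv (𝓡 n) (𝓡 n) e.symm y).toLinearMap) _ _

theorem inChart_smul (r : M → ℝ) (A : EndForm n M E) (e : OpenPartialHomeomorph M (Coord n))
    (y : Coord n) :
    EndForm.inChart (fun x => r x • A x) e y = r (e.symm y) • A.inChart e y :=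
  map_smul (pullEnd E (mfderiv (𝓡 n) (𝓡 n) e.symm y).toLinearMap) _ _

theorem inChart_const_smul (r : ℝ) (A : EndForm n M E) (e : OpenPartialHomeomorph M (Coord n))
    (y : Coord n) : (r • A).inChart e y = r • A.inChart e y :=
  inChart_smul (fun _ => r) A e y

theorem inChart_one (e : OpenPartialHomeomorph M (Coord n)) (y : Coord n) :
    EndForm.inChart (1 : EndForm n M E) e y = 1 := by
  -- The type ascription identifies the tangent spaces with `ℝⁿ`, so that `pullEnd` acts between the
  -- coordinate fibres.
  let L : Coord n →ₗ[ℝ] Coord n := (mfderiv (𝓡 n) (𝓡 n) e.symm y).toLinearMap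
  change pullEnd E L (1 : EndFiber (Coord n) E) = 1
  exact (pullEnd E L).map_one

variable (n M E) in
/-- The endomorphism of the algebra of forms that multiplies `k`-forms by `c ^ k`. -/
def scale (c : ℝ) : EndForm n M E →ₐ[ℝ] EndForm n M E :=
  AlgHom.pi fun x => (scaleEnd (TangentSpace (𝓡 n) x) E c).comp (Pi.evalAlgHom ℝ _ x)

theorem inChart_scale (c : ℝ) (A : EndForm n M E) (e : OpenPartialHomeomorph M (Coord n))
    (y : Coord n) :
    (scale n M E c A).inChart e y = scaleEnd (Coord n) E c (A.inChart e y) :=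
  (scaleEnd_pullEnd E _ c _).symm

end EndForm

variable {e c : OpenPartialHomeomorph M (Coord n)}

theorem contDiffOn_transition (he : e ∈ IsManifold.maximalAtlas (𝓡 n) ∞ M)
    (hc : c ∈ IsManifold.maximalAtlas (𝓡 n) ∞ M) :
    ContDiffOn ℝ ∞ (c ∘ e.symm) (e.symm.trans c).source := by
  rw [← contMDiffOn_iff_contDiffOn]
  refine (contMDiffOn_of_mem_maximalAtlas hc).comp
    ((contMDiffOn_symm_of_mem_maximalAtlas he).mono fun y hy => ?_) fun y hy => ?_
  · rw [OpenPartialHomeomorph.trans_source] at hy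
    exact hy.1
  · rw [OpenPartialHomeomorph.trans_source] at hy
    exact hy.2

theorem mdifferentiableAt_chart (he : e ∈ IsManifold.maximalAtlas (𝓡 n) ∞ M) {x : M}
    (hx : x ∈ e.source) : MDifferentiableAt (𝓡 n) (𝓡 n) e x :=
  ((contMDiffOn_of_mem_maximalAtlas he).contMDiffAt (e.open_source.mem_nhds hx)).mdifferentiableAt
    (by simp)

theorem mdifferentiableAt_chart_symm (he : e ∈ IsManifold.maximalAtlas (𝓡 n) ∞ M) {y : Coord n}
    (hy : y ∈ e.target) : MDifferentiableAt (𝓡 n) (𝓡 n) e.symm y :=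
  ((contMDiffOn_symm_of_mem_maximalAtlas he).contMDiffAt
    (e.open_target.mem_nhds hy)).mdifferentiableAt (by simp)

/-- The derivative of the inverse of the chart `e`. -/
def derivSymm (e : OpenPartialHomeomorph M (Coord n)) (y : Coord n) : Coord n →ₗ[ℝ] Coord n :=
  (mfderiv (𝓡 n) (𝓡 n) e.symm y).toLinearMap

/-- The derivative of the chart `e`. -/
def derivChart (e : OpenPartialHomeomorph M (Coord n)) (x : M) : Coord n →ₗ[ℝ] Coord n :=
  (mfderiv (𝓡 n) (𝓡 n) e x).toLinearMap

/-- The value at `x`, with the tangent space identified with `ℝⁿ`. -/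
def EndForm.val (A : EndForm n M E) (x : M) : EndFiber (Coord n) E := A x

theorem EndForm.inChart_eq (A : EndForm n M E) (e : OpenPartialHomeomorph M (Coord n))
    (y : Coord n) : A.inChart e y = pullEnd E (derivSymm e y) (A.val (e.symm y)) := rfl

theorem EndForm.val_d [FiniteDimensional ℝ E] (A : EndForm n M E) (x : M) :
    A.d.val x = pullEnd E (derivChart (chartAt (Coord n) x) x)
      (extDerivCoord (A.inChart (chartAt (Coord n) x)) (chartAt (Coord n) x x)) := rfl

/-- A form in the chart `e` is the pull-back of the form in the chart `c`. -/
theorem EndForm.inChart_eq_pullAlong (A : EndForm n M E)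
    (he : e ∈ IsManifold.maximalAtlas (𝓡 n) ∞ M) (hc : c ∈ IsManifold.maximalAtlas (𝓡 n) ∞ M)
    {y : Coord n} (hy : y ∈ (e.symm.trans c).source) :
    A.inChart e y = pullAlong (c ∘ e.symm) (A.inChart c) y := by
  have hy' : y ∈ e.target ∧ e.symm y ∈ c.source := by
    rwa [OpenPartialHomeomorph.trans_source] at hy
  have hφ : MDifferentiableAt (𝓡 n) (𝓡 n) (c ∘ e.symm) y :=
    (mdifferentiableAt_chart hc hy'.2).comp y (mdifferentiableAt_chart_symm he hy'.1)
  have h2 : c.symm ((c ∘ e.symm) y) = e.symm y := c.left_inv hy'.2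
  have hev : e.symm =ᶠ[nhds y] c.symm ∘ (c ∘ e.symm) := by
    filter_upwards [(e.symm.trans c).open_source.mem_nhds hy] with z hz
    rw [OpenPartialHomeomorph.trans_source] at hz
    exact (c.left_inv hz.2).symm
  have h1 : derivSymm e y =
      derivSymm c ((c ∘ e.symm) y) ∘ₗ (fderiv ℝ (c ∘ e.symm) y).toLinearMap := by
    have := mfderiv_comp (I := 𝓡 n) (I' := 𝓡 n) (I'' := 𝓡 n) y
      (mdifferentiableAt_chart_symm hc (c.map_source hy'.2)) hφ
    rw [mfderiv_eq_fderiv] at this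
    exact congrArg (ContinuousLinearMap.toLinearMap (M := Coord n) (M₂ := Coord n))
      (hev.mfderiv_eq.trans this)
  rw [pullAlong, EndForm.inChart_eq, EndForm.inChart_eq, h2, ← pullEnd_comp, h1]

theorem derivSymm_comp_derivChart (he : e ∈ IsManifold.maximalAtlas (𝓡 n) ∞ M) {x : M}
    (hx : x ∈ e.source) : derivSymm e (e x) ∘ₗ derivChart e x = LinearMap.id := by
  have h1 := mfderiv_comp (I := 𝓡 n) (I' := 𝓡 n) (I'' := 𝓡 n) x
    (mdifferentiableAt_chart_symm he (e.map_source hx)) (mdifferentiableAt_chart he hx)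
  have hev : e.symm ∘ e =ᶠ[nhds x] id := by
    filter_upwards [e.open_source.mem_nhds hx] with z hz
    exact e.left_inv hz
  have h2 := hev.mfderiv_eq (I := 𝓡 n) (I' := 𝓡 n)
  rw [mfderiv_id] at h2
  exact congrArg (ContinuousLinearMap.toLinearMap (M := Coord n) (M₂ := Coord n))
    (h1.symm.trans h2)

theorem derivChart_comp_derivSymm (he : e ∈ IsManifold.maximalAtlas (𝓡 n) ∞ M)
    (hc : c ∈ IsManifold.maximalAtlas (𝓡 n) ∞ M) {y : Coord n}
    (hy : y ∈ (e.symm.trans c).source) :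
    derivChart c (e.symm y) ∘ₗ derivSymm e y = (fderiv ℝ (c ∘ e.symm) y).toLinearMap := by
  have hy' : y ∈ e.target ∧ e.symm y ∈ c.source := by
    rwa [OpenPartialHomeomorph.trans_source] at hy
  have h1 := mfderiv_comp (I := 𝓡 n) (I' := 𝓡 n) (I'' := 𝓡 n) y
    (mdifferentiableAt_chart hc hy'.2) (mdifferentiableAt_chart_symm he hy'.1)
  rw [mfderiv_eq_fderiv] at h1
  exact congrArg (ContinuousLinearMap.toLinearMap (M := Coord n) (M₂ := Coord n)) h1.symm

/-- A form is determined by its expression in a chart. -/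
theorem EndForm.val_eq_pullEnd_inChart (A : EndForm n M E)
    (he : e ∈ IsManifold.maximalAtlas (𝓡 n) ∞ M) {x : M} (hx : x ∈ e.source) :
    A.val x = pullEnd E (derivChart e x) (A.inChart e (e x)) := by
  rw [EndForm.inChart_eq, e.left_inv hx, ← pullEnd_comp, derivSymm_comp_derivChart he hx,
    pullEnd_id]

theorem EndForm.ext_val {A B : EndForm n M E} (h : ∀ x, A.val x = B.val x) : A = B :=
  funext h

theorem EndForm.isSmooth_of_contDiffOn [FiniteDimensional ℝ E] {A : EndForm n M E}
    (h : ∀ e ∈ atlas (Coord n) M, ContDiffOn ℝ ∞ (A.inChart e) e.target) : A.IsSmooth :=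
  fun e he => smoothOnCoord_iff.2 (h e he)

variable [IsManifold (𝓡 n) ∞ M]

theorem chartAt_mem_maximalAtlas (x : M) :
    chartAt (Coord n) x ∈ IsManifold.maximalAtlas (𝓡 n) ∞ M :=
  IsManifold.chart_mem_maximalAtlas x

theorem EndForm.ext_inChart {A B : EndForm n M E}
    (h : ∀ x : M, A.inChart (chartAt (Coord n) x) (chartAt (Coord n) x x) =
      B.inChart (chartAt (Coord n) x) (chartAt (Coord n) x x)) : A = B := by
  refine EndForm.ext_val fun x => ?_
  rw [A.val_eq_pullEnd_inChart (chartAt_mem_maximalAtlas x) (mem_chart_source _ x),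
    B.val_eq_pullEnd_inChart (chartAt_mem_maximalAtlas x) (mem_chart_source _ x), h]

variable [FiniteDimensional ℝ E]

/-- `IsSmooth` speaks of the given atlas, while oriented charts are only in the maximal one. Near
each point the form in the chart `e` is pulled back from a chart of the atlas by a smooth transition
map. -/
theorem EndForm.IsSmooth.contDiffOn {A : EndForm n M E} (hA : A.IsSmooth)
    (he : e ∈ IsManifold.maximalAtlas (𝓡 n) ∞ M) : ContDiffOn ℝ ∞ (A.inChart e) e.target := by
  intro y hy
  set c := chartAt (Coord n) (e.symm y)
  have hc : c ∈ IsManifold.maximalAtlas (𝓡 n) ∞ M := chartAt_mem_maximalAtlas _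
  have hyU : y ∈ (e.symm.trans c).source := by
    rw [OpenPartialHomeomorph.trans_source]
    exact ⟨hy, mem_chart_source _ (e.symm y)⟩
  have h := contDiffOn_pullAlong (e.symm.trans c).open_source (contDiffOn_transition he hc)
    (smoothOnCoord_iff.1 (hA c (chart_mem_atlas _ _))) (fun z hz => by
      rw [OpenPartialHomeomorph.trans_source] at hz
      exact c.map_source hz.2)
  have hopen := (e.symm.trans c).open_source.mem_nhds hyU
  refine ((h.contDiffAt hopen).congr_of_eventuallyEq ?_).contDiffWithinAt
  filter_upwards [hopen] with z hz
  exact A.inChart_eq_pullAlong he hc hz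

/-- The exterior derivative can be computed in each chart of the smooth structure. -/
theorem EndForm.IsSmooth.inChart_d {A : EndForm n M E} (hA : A.IsSmooth)
    (he : e ∈ IsManifold.maximalAtlas (𝓡 n) ∞ M) {y : Coord n} (hy : y ∈ e.target) :
    A.d.inChart e y = extDerivCoord (A.inChart e) y := by
  set c := chartAt (Coord n) (e.symm y) with hcdef
  have hc : c ∈ IsManifold.maximalAtlas (𝓡 n) ∞ M := chartAt_mem_maximalAtlas _
  have hyc : e.symm y ∈ c.source := mem_chart_source _ (e.symm y)
  have hyU : y ∈ (e.symm.trans c).source := by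
    rw [OpenPartialHomeomorph.trans_source]
    exact ⟨hy, hyc⟩
  have h1 : A.d.inChart e y = pullAlong (c ∘ e.symm) (extDerivCoord (A.inChart c)) y := by
    rw [EndForm.inChart_eq, EndForm.val_d, ← pullEnd_comp, derivChart_comp_derivSymm he hc hyU]
    rfl
  have hev : A.inChart e =ᶠ[nhds y] pullAlong (c ∘ e.symm) (A.inChart c) := by
    filter_upwards [(e.symm.trans c).open_source.mem_nhds hyU] with z hz
    exact A.inChart_eq_pullAlong he hc hz
  rw [h1, extDerivCoord_congr hev, extDerivCoord_pullAlong (e.symm.trans c).open_source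
    (contDiffOn_transition he hc) hyU]
  exact differentiableAt_of_contDiffOn c.open_target (hA.contDiffOn hc) (c.map_source hyc)

theorem EndForm.IsSmooth.differentiableAt {A : EndForm n M E} (hA : A.IsSmooth)
    (he : e ∈ IsManifold.maximalAtlas (𝓡 n) ∞ M) {y : Coord n} (hy : y ∈ e.target) :
    DifferentiableAt ℝ (A.inChart e) y :=
  differentiableAt_of_contDiffOn e.open_target (hA.contDiffOn he) hy

theorem mem_maximalAtlas_of_mem_atlas (he : e ∈ atlas (Coord n) M) :
    e ∈ IsManifold.maximalAtlas (𝓡 n) ∞ M :=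
  IsManifold.subset_maximalAtlas he

variable (n M E) in
/-- The algebra of smooth forms. -/
def smoothForms : Subalgebra ℝ (EndForm n M E) where
  carrier := {A | A.IsSmooth}
  mul_mem' {A B} hA hB := EndForm.isSmooth_of_contDiffOn fun e he => by
    have he' := mem_maximalAtlas_of_mem_atlas he
    exact (contDiffOn_mul (hA.contDiffOn he') (hB.contDiffOn he')).congr fun y _ =>
      EndForm.inChart_mul A B e y
  add_mem' {A B} hA hB := EndForm.isSmooth_of_contDiffOn fun e he => by
    have he' := mem_maximalAtlas_of_mem_atlas he
    exact ((hA.contDiffOn he').add (hB.contDiffOn he')).congr fun y _ =>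
      EndForm.inChart_add A B e y
  algebraMap_mem' r := EndForm.isSmooth_of_contDiffOn fun e _ => by
    rw [Algebra.algebraMap_eq_smul_one]
    refine ContDiffOn.congr (contDiffOn_const (c := r • (1 : EndFiber (Coord n) E))) fun y _ => ?_
    rw [EndForm.inChart_const_smul, EndForm.inChart_one]

theorem EndForm.IsSmooth.d {A : EndForm n M E} (hA : A.IsSmooth) : A.d.IsSmooth :=
  EndForm.isSmooth_of_contDiffOn fun e he => by
    have he' := mem_maximalAtlas_of_mem_atlas he
    exact (contDiffOn_extDerivCoord e.open_target (hA.contDiffOn he')).congr fun y hy =>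
      hA.inChart_d he' hy

theorem EndForm.IsSmooth.scale {A : EndForm n M E} (hA : A.IsSmooth) (c : ℝ) :
    (EndForm.scale n M E c A).IsSmooth :=
  EndForm.isSmooth_of_contDiffOn fun e he =>
    ((contDiff_linearMap (scaleEnd (Coord n) E c).toLinearMap).comp_contDiffOn
      (hA.contDiffOn (mem_maximalAtlas_of_mem_atlas he))).congr fun y _ =>
        EndForm.inChart_scale c A e y

/-- Multiplication by a smooth function. -/
theorem EndForm.IsSmooth.smul_fun {A : EndForm n M E} (hA : A.IsSmooth) {r : M → ℝ}
    (hr : ContMDiff (𝓡 n) 𝓘(ℝ) ∞ r) : EndForm.IsSmooth (fun x => r x • A x : EndForm n M E) :=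
  EndForm.isSmooth_of_contDiffOn fun e he => by
    have he' := mem_maximalAtlas_of_mem_atlas he
    have h : ContDiffOn ℝ ∞ (fun y => r (e.symm y)) e.target := by
      rw [← contMDiffOn_iff_contDiffOn]
      exact hr.comp_contMDiffOn (contMDiffOn_symm_of_mem_maximalAtlas he')
    exact (h.smul (hA.contDiffOn he')).congr fun y _ => EndForm.inChart_smul r A e y

theorem EndForm.IsSmooth.d_add {A B : EndForm n M E} (hA : A.IsSmooth) (hB : B.IsSmooth) :
    (A + B).d = A.d + B.d := by
  have hAB : (A + B).IsSmooth := (smoothForms n M E).add_mem hA hB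
  refine EndForm.ext_inChart fun x => ?_
  have he := chartAt_mem_maximalAtlas (n := n) x
  have hy := mem_chart_target (Coord n) x
  rw [hAB.inChart_d he hy, EndForm.inChart_add, hA.inChart_d he hy, hB.inChart_d he hy,
    ← extDerivCoord_add (hA.differentiableAt he hy) (hB.differentiableAt he hy)]
  exact extDerivCoord_congr (Filter.Eventually.of_forall fun z => EndForm.inChart_add A B _ z)

theorem EndForm.IsSmooth.d_smul {A : EndForm n M E} (hA : A.IsSmooth) (r : ℝ) :
    (r • A).d = r • A.d := by
  have hrA : (r • A).IsSmooth := (smoothForms n M E).smul_mem hA r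
  refine EndForm.ext_inChart fun x => ?_
  have he := chartAt_mem_maximalAtlas (n := n) x
  have hy := mem_chart_target (Coord n) x
  rw [hrA.inChart_d he hy, EndForm.inChart_const_smul, hA.inChart_d he hy,
    extDerivCoord_congr (Filter.Eventually.of_forall fun z =>
      EndForm.inChart_const_smul r A _ z),
    extDerivCoord_smul (differentiableAt_const r) (hA.differentiableAt he hy), fderiv_fun_const]
  have : oneForm E ((0 : Coord n →L[ℝ] ℝ) : Coord n →ₗ[ℝ] ℝ) = 0 := by
    have := oneForm_smul E (0 : ℝ) (0 : Module.Dual ℝ (Coord n))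
    rwa [zero_smul, zero_smul] at this
  rw [Pi.zero_apply, this, zero_mul, zero_add]

theorem EndForm.IsSmooth.d_mul {A B : EndForm n M E} (hA : A.IsSmooth) (hB : B.IsSmooth) :
    (A * B).d = A.d * B + EndForm.scale n M E (-1) A * B.d := by
  have hAB : (A * B).IsSmooth := (smoothForms n M E).mul_mem hA hB
  refine EndForm.ext_inChart fun x => ?_
  have he := chartAt_mem_maximalAtlas (n := n) x
  have hy := mem_chart_target (Coord n) x
  rw [hAB.inChart_d he hy, EndForm.inChart_add, EndForm.inChart_mul, EndForm.inChart_mul,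
    hA.inChart_d he hy, hB.inChart_d he hy, EndForm.inChart_scale,
    ← extDerivCoord_mul (hA.differentiableAt he hy) (hB.differentiableAt he hy)]
  exact extDerivCoord_congr (Filter.Eventually.of_forall fun z => EndForm.inChart_mul A B _ z)

theorem EndForm.IsSmooth.d_d {A : EndForm n M E} (hA : A.IsSmooth) : A.d.d = 0 := by
  refine EndForm.ext_inChart fun x => ?_
  have he := chartAt_mem_maximalAtlas (n := n) x
  have hy := mem_chart_target (Coord n) x
  have hev : A.d.inChart (chartAt (Coord n) x) =ᶠ[nhds (chartAt (Coord n) x x)]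
      extDerivCoord (A.inChart (chartAt (Coord n) x)) := by
    filter_upwards [(chartAt (Coord n) x).open_target.mem_nhds hy] with z hz
    exact hA.inChart_d he hz
  rw [hA.d.inChart_d he hy, extDerivCoord_congr hev,
    extDerivCoord_extDerivCoord (chartAt (Coord n) x).open_target (hA.contDiffOn he) hy]
  have := EndForm.inChart_const_smul (0 : ℝ) (0 : EndForm n M E) (chartAt (Coord n) x)
    (chartAt (Coord n) x x)
  rw [zero_smul, zero_smul] at this
  exact this.symm

theorem EndForm.IsSmooth.scale_d {A : EndForm n M E} (hA : A.IsSmooth) (r : ℝ) :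
    EndForm.scale n M E r A.d = r • (EndForm.scale n M E r A).d := by
  refine EndForm.ext_inChart fun x => ?_
  have he := chartAt_mem_maximalAtlas (n := n) x
  have hy := mem_chart_target (Coord n) x
  have hev : extDerivCoord ((EndForm.scale n M E r A).inChart (chartAt (Coord n) x))
      (chartAt (Coord n) x x) = extDerivCoord (fun z => scaleEnd (Coord n) E r
        (A.inChart (chartAt (Coord n) x) z)) (chartAt (Coord n) x x) :=
    extDerivCoord_congr (Filter.Eventually.of_forall fun z => EndForm.inChart_scale r A _ z)
  rw [EndForm.inChart_scale, hA.inChart_d he hy, EndForm.inChart_const_smul,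
    (hA.scale r).inChart_d he hy, scaleEnd_extDerivCoord (hA.differentiableAt he hy), hev]

end ManifoldForms

/-! ### Integration over the manifold -/

section ManifoldIntegral

open MeasureTheory

variable {n : ℕ} {M : Type*} [TopologicalSpace M] [ChartedSpace (Coord n) M]
  {E : Type*} [AddCommGroup E] [Module ℝ E]

/-- The product of a function and a form. -/
def EndForm.fsmul (r : M → ℝ) (A : EndForm n M E) : EndForm n M E := fun x => r x • A x

theorem EndForm.val_fsmul (r : M → ℝ) (A : EndForm n M E) (x : M) :
    (A.fsmul r).val x = r x • A.val x := rfl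

theorem EndForm.inChart_fsmul (r : M → ℝ) (A : EndForm n M E)
    (e : OpenPartialHomeomorph M (Coord n)) (y : Coord n) :
    (A.fsmul r).inChart e y = r (e.symm y) • A.inChart e y :=
  EndForm.inChart_smul r A e y

/-- The integral of the trace of a form over the domain of a chart. -/
def EndForm.chartIntegral (A : EndForm n M E) (e : OpenPartialHomeomorph M (Coord n)) : ℝ :=
  ∫ y in e.target, topTr n E (A.inChart e y)

theorem EndForm.inChart_eq_zero {A : EndForm n M E} {e : OpenPartialHomeomorph M (Coord n)}
    {y : Coord n} (h : A.val (e.symm y) = 0) : A.inChart e y = 0 := by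
  rw [EndForm.inChart_eq, h, map_zero]

/-- The integral over the domain of a chart depends on the orientation only. -/
theorem EndForm.chartIntegral_eq (o : OrientedAtlas n M) (A : EndForm n M E)
    {e c : OpenPartialHomeomorph M (Coord n)} (he : e ∈ o.charts) (hc : c ∈ o.charts)
    (hA : ∀ x, ¬(x ∈ e.source ∧ x ∈ c.source) → A.val x = 0) :
    A.chartIntegral e = A.chartIntegral c := by
  have hsub : ∀ {e c : OpenPartialHomeomorph M (Coord n)},
      (∀ x, ¬(x ∈ e.source ∧ x ∈ c.source) → A.val x = 0) →
      A.chartIntegral e = ∫ y in (e.symm.trans c).source, topTr n E (A.inChart e y) := by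
    intro e c hA
    refine setIntegral_eq_of_subset_of_forall_sdiff_eq_zero (μ := volume)
      (f := fun y => topTr n E (A.inChart e y)) e.open_target.measurableSet
      (fun y hy => ?_) fun y hy => ?_
    · rw [OpenPartialHomeomorph.trans_source] at hy
      exact hy.1
    · rw [EndForm.inChart_eq_zero, map_zero]
      refine hA _ fun h => hy.2 ?_
      rw [OpenPartialHomeomorph.trans_source]
      exact ⟨hy.1, h.2⟩
  -- Both integrals are restricted to the overlap of the two charts, outside which the form
  -- vanishes.
  rw [hsub hA, hsub (e := c) (c := e) fun x hx => hA x fun h => hx h.symm]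
  have hφ := contDiffOn_transition (o.mem_maximalAtlas e he) (o.mem_maximalAtlas c hc)
  have hu := (e.symm.trans c).open_source
  have htarget : (c.symm.trans e).source = (e.symm.trans c).target := by
    rw [OpenPartialHomeomorph.trans_source, OpenPartialHomeomorph.trans_target]
    rfl
  -- Change of variables gives the absolute value of the Jacobian and `topTr_pullEnd` the Jacobian
  -- itself; they agree because the atlas is oriented.
  rw [htarget, integral_target_eq_integral_abs_det_fderiv_smul (μ := volume)
    (f := e.symm.trans c) (f' := fun y => fderiv ℝ (c ∘ e.symm) y)
    (fun y hy => (differentiableAt_of_contDiffOn hu hφ hy).hasFDerivAt)]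
  refine setIntegral_congr_fun hu.measurableSet fun y hy => ?_
  have h1 := A.inChart_eq_pullAlong (o.mem_maximalAtlas e he) (o.mem_maximalAtlas c hc) hy
  have h2 : 0 < (fderiv ℝ (c ∘ e.symm) y).det := o.det_pos e he c hc y hy
  simp only [h1, pullAlong, topTr_pullEnd, abs_of_pos h2, smul_eq_mul]
  rfl

variable [FiniteDimensional ℝ E]

theorem EndForm.IsSmooth.fsmul [IsManifold (𝓡 n) ∞ M] {A : EndForm n M E} (hA : A.IsSmooth)
    {r : M → ℝ} (hr : ContMDiff (𝓡 n) 𝓘(ℝ) ∞ r) : (A.fsmul r).IsSmooth :=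
  hA.smul_fun hr

/-- The exterior derivative does not increase supports. -/
theorem EndForm.val_d_eq_zero {A : EndForm n M E} {x : M} (h : ∀ᶠ z in nhds x, A.val z = 0) :
    A.d.val x = 0 := by
  have hx := mem_chart_source (Coord n) x
  have hcont : Filter.Tendsto (chartAt (Coord n) x).symm (nhds (chartAt (Coord n) x x))
      (nhds x) := by
    have := (chartAt (Coord n) x).continuousAt_symm ((chartAt (Coord n) x).map_source hx)
    rwa [ContinuousAt, (chartAt (Coord n) x).left_inv hx] at this
  have hev : A.inChart (chartAt (Coord n) x) =ᶠ[nhds (chartAt (Coord n) x x)] fun _ => 0 := by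
    filter_upwards [hcont.eventually h] with y hy
    exact EndForm.inChart_eq_zero hy
  rw [EndForm.val_d, extDerivCoord_congr hev, extDerivCoord_const, map_zero]

variable [IsManifold (𝓡 n) ∞ M] [CompactSpace M]

theorem image_isCompact {e : OpenPartialHomeomorph M (Coord n)} {Z : Set M} (hZ : IsClosed Z)
    (hZe : Z ⊆ e.source) : IsCompact (e '' Z) ∧ e '' Z ⊆ e.target := by
  refine ⟨hZ.isCompact.image_of_continuousOn (e.continuousOn.mono hZe), ?_⟩
  rintro _ ⟨x, hx, rfl⟩
  exact e.map_source (hZe hx)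

theorem EndForm.inChart_eq_zero_of_notMem {A : EndForm n M E}
    {e : OpenPartialHomeomorph M (Coord n)} {Z : Set M} (h0 : ∀ x, x ∉ Z → A.val x = 0)
    {y : Coord n} (hy : y ∈ e.target) (hyZ : y ∉ e '' Z) : A.inChart e y = 0 :=
  EndForm.inChart_eq_zero (h0 _ fun h => hyZ ⟨_, h, e.right_inv hy⟩)

theorem EndForm.IsSmooth.integrableOn {A : EndForm n M E} (hA : A.IsSmooth)
    {e : OpenPartialHomeomorph M (Coord n)} (he : e ∈ IsManifold.maximalAtlas (𝓡 n) ∞ M)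
    {Z : Set M} (hZ : IsClosed Z) (hZe : Z ⊆ e.source) (h0 : ∀ x, x ∉ Z → A.val x = 0) :
    IntegrableOn (fun y => topTr n E (A.inChart e y)) e.target := by
  obtain ⟨hC, hCe⟩ := image_isCompact hZ hZe
  have hcont : ContinuousOn (fun y => topTr n E (A.inChart e y)) e.target :=
    ((contDiff_linearMap (topTr n E)).comp_contDiffOn (hA.contDiffOn he)).continuousOn
  refine IntegrableOn.of_forall_sdiff_eq_zero ((hcont.mono hCe).integrableOn_compact hC)
    e.open_target.measurableSet fun y hy => ?_
  rw [EndForm.inChart_eq_zero_of_notMem h0 hy.1 hy.2, map_zero]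

theorem EndForm.IsSmooth.chartIntegral_d {A : EndForm n M E} (hA : A.IsSmooth)
    {e : OpenPartialHomeomorph M (Coord n)} (he : e ∈ IsManifold.maximalAtlas (𝓡 n) ∞ M)
    {Z : Set M} (hZ : IsClosed Z) (hZe : Z ⊆ e.source) (h0 : ∀ x, x ∉ Z → A.val x = 0) :
    A.d.chartIntegral e = 0 := by
  obtain ⟨hC, hCe⟩ := image_isCompact hZ hZe
  rw [← setIntegral_topTr_extDerivCoord e.open_target hC hCe (hA.contDiffOn he) fun y hy hyC =>
    EndForm.inChart_eq_zero_of_notMem h0 hy hyC]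
  exact setIntegral_congr_fun e.open_target.measurableSet fun y hy => by
    simp only [hA.inChart_d he hy]

variable [T2Space M] (o : OrientedAtlas n M)

/-! ### Integration by means of the partition of unity -/

namespace OrientedAtlas

theorem chart_mem (i : M) : o.chart i ∈ o.charts := (o.cover i).choose_spec.1

theorem chart_mem_maximalAtlas (i : M) : o.chart i ∈ IsManifold.maximalAtlas (𝓡 n) ∞ M :=
  o.mem_maximalAtlas _ (o.chart_mem i)

theorem tsupport_subset (i : M) : tsupport (o.partition i) ⊆ (o.chart i).source :=
  o.exists_partition.choose_spec i

theorem val_fsmul_eq_zero (A : EndForm n M E) (i : M) {x : M}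
    (hx : x ∉ tsupport (o.partition i)) : (A.fsmul (o.partition i)).val x = 0 := by
  rw [EndForm.val_fsmul, image_eq_zero_of_notMem_tsupport hx, zero_smul]

theorem finite_index : {i | (Function.support (o.partition i)).Nonempty}.Finite :=
  o.partition.locallyFinite.finite_nonempty_of_compact

/-- The indices of the functions of the partition of unity that do not vanish. -/
def indices : Finset M := o.finite_index.toFinset

theorem partition_eq_zero {i : M} (hi : i ∉ o.indices) (x : M) : o.partition i x = 0 := by
  by_contra h
  exact hi (o.finite_index.mem_toFinset.2 ⟨x, h⟩)

theorem sum_partition (x : M) : ∑ i ∈ o.indices, o.partition i x = 1 := by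
  rw [← o.partition.sum_eq_one (Set.mem_univ x)]
  refine (finsum_eq_sum_of_support_subset _ fun i hi => ?_).symm
  by_contra h
  exact hi (o.partition_eq_zero h x)

theorem integral_tr (A : EndForm n M E) :
    o.integral A.tr = ∑ i ∈ o.indices, (A.fsmul (o.partition i)).chartIntegral (o.chart i) := by
  have h : ∀ i : M, ∀ y, (dxI n).coord Finset.univ (ScalarForm.inChart
      (fun x => o.partition i x • A.tr x) (o.chart i) y) =
      topTr n E ((A.fsmul (o.partition i)).inChart (o.chart i) y) := by
    intro i y
    rw [EndForm.inChart_eq, topTr, LinearMap.comp_apply, trFiber_pullEnd, EndForm.val_fsmul,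
      map_smul]
    rfl
  simp only [OrientedAtlas.integral, h]
  refine finsum_eq_sum_of_support_subset _ fun i hi => ?_
  by_contra hn
  refine hi (integral_eq_zero_of_ae (Filter.Eventually.of_forall fun y => ?_))
  have h0 : o.partition i ((o.chart i).symm y) = 0 := o.partition_eq_zero hn _
  simp only [EndForm.inChart_fsmul, h0, zero_smul, map_zero, Pi.zero_apply]

variable {A B : EndForm n M E}

theorem fsmul_isSmooth (hA : A.IsSmooth) (i : M) : (A.fsmul (o.partition i)).IsSmooth :=
  hA.fsmul (o.partition i).contMDiff

theorem integrableOn_fsmul (hA : A.IsSmooth) (i : M) :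
    IntegrableOn (fun y => topTr n E ((A.fsmul (o.partition i)).inChart (o.chart i) y))
      (o.chart i).target :=
  (o.fsmul_isSmooth hA i).integrableOn (o.chart_mem_maximalAtlas i) (isClosed_tsupport _)
    (o.tsupport_subset i) fun _ hx => o.val_fsmul_eq_zero A i hx

theorem integral_tr_add (hA : A.IsSmooth) (hB : B.IsSmooth) :
    o.integral (A + B).tr = o.integral A.tr + o.integral B.tr := by
  rw [integral_tr, integral_tr, integral_tr, ← Finset.sum_add_distrib]
  refine Finset.sum_congr rfl fun i _ => ?_
  rw [EndForm.chartIntegral, EndForm.chartIntegral, EndForm.chartIntegral,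
    ← integral_add (o.integrableOn_fsmul hA i) (o.integrableOn_fsmul hB i)]
  simp only [EndForm.inChart_fsmul, EndForm.inChart_add, smul_add, map_add]

theorem integral_tr_smul (r : ℝ) (A : EndForm n M E) :
    o.integral (r • A).tr = r * o.integral A.tr := by
  rw [integral_tr, integral_tr, Finset.mul_sum]
  refine Finset.sum_congr rfl fun i _ => ?_
  rw [EndForm.chartIntegral, EndForm.chartIntegral, ← integral_const_mul]
  simp only [EndForm.inChart_fsmul, EndForm.inChart_const_smul, map_smul, smul_eq_mul]
  congr 1
  funext y
  ring

theorem integral_tr_mul_comm (hn : Odd n) (A B : EndForm n M E) :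
    o.integral (A * B).tr = o.integral (B * A).tr := by
  rw [integral_tr, integral_tr]
  refine Finset.sum_congr rfl fun i _ => ?_
  rw [EndForm.chartIntegral, EndForm.chartIntegral]
  simp only [EndForm.inChart_fsmul, EndForm.inChart_mul, map_smul, topTr_mul_comm n hn]

/-- Each summand is supported in both the `j`-th and the `i`-th chart and can be computed in the
latter; there the functions of the partition add up to `1`. -/
theorem integral_tr_of_support (hA : A.IsSmooth) (i : M)
    (h0 : ∀ x, x ∉ tsupport (o.partition i) → A.val x = 0) :
    o.integral A.tr = A.chartIntegral (o.chart i) := by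
  have hj : ∀ j, (A.fsmul (o.partition j)).chartIntegral (o.chart j) =
      (A.fsmul (o.partition j)).chartIntegral (o.chart i) := by
    refine fun j => EndForm.chartIntegral_eq o _ (o.chart_mem j) (o.chart_mem i) fun x hx => ?_
    by_cases hxj : x ∈ tsupport (o.partition j)
    · have hxi : x ∉ tsupport (o.partition i) := fun hxi =>
        hx ⟨o.tsupport_subset j hxj, o.tsupport_subset i hxi⟩
      rw [EndForm.val_fsmul, h0 x hxi, smul_zero]
    · exact o.val_fsmul_eq_zero A j hxj
  rw [integral_tr, Finset.sum_congr rfl fun j _ => hj j]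
  simp only [EndForm.chartIntegral]
  rw [← integral_finsetSum _ fun j _ => (o.fsmul_isSmooth hA j).integrableOn
    (o.chart_mem_maximalAtlas i) (isClosed_tsupport _) (o.tsupport_subset i) fun x hx => by
      rw [EndForm.val_fsmul, h0 x hx, smul_zero]]
  simp only [EndForm.inChart_fsmul, map_smul, smul_eq_mul, ← Finset.sum_mul, sum_partition,
    one_mul]

/-- Since `d` does not enlarge supports, the integral is computed in one chart, where Stokes'
theorem in `ℝⁿ` applies. -/
theorem integral_tr_d_fsmul (hA : A.IsSmooth) (i : M) :
    o.integral (A.fsmul (o.partition i)).d.tr = 0 := by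
  have hs := o.fsmul_isSmooth hA i
  rw [o.integral_tr_of_support hs.d i fun x hx => EndForm.val_d_eq_zero ?_]
  · exact hs.chartIntegral_d (o.chart_mem_maximalAtlas i) (isClosed_tsupport _)
      (o.tsupport_subset i) fun _ hx => o.val_fsmul_eq_zero A i hx
  · filter_upwards [(isClosed_tsupport (o.partition i)).isOpen_compl.mem_nhds hx] with z hz
    exact o.val_fsmul_eq_zero A i hz

end OrientedAtlas

variable (n M E) in
/-- The exterior derivative on smooth forms. -/
def smoothD : smoothForms n M E →ₗ[ℝ] smoothForms n M E where
  toFun A := ⟨A.1.d, A.2.d⟩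
  map_add' A B := Subtype.ext (EndForm.IsSmooth.d_add A.2 B.2)
  map_smul' r A := Subtype.ext (EndForm.IsSmooth.d_smul A.2 r)

variable (E) in
/-- The integral of the trace on smooth forms. -/
def smoothInt : smoothForms n M E →ₗ[ℝ] ℝ where
  toFun A := o.integral A.1.tr
  map_add' A B := o.integral_tr_add A.2 B.2
  map_smul' r A := o.integral_tr_smul r A.1

variable (n M E) in
/-- The grading involution on smooth forms. -/
def smoothInvol : smoothForms n M E →ₐ[ℝ] smoothForms n M E :=
  ((EndForm.scale n M E (-1)).comp (smoothForms n M E).val).codRestrict (smoothForms n M E)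
    fun A => EndForm.IsSmooth.scale A.2 (-1)

/-- **Stokes' theorem** on a closed manifold. -/
theorem smoothInt_smoothD (A : smoothForms n M E) : smoothInt E o (smoothD n M E A) = 0 := by
  -- By linearity of `d` and of the integral it is enough to treat the pieces `ρᵢ A`.
  have h : A = ∑ i ∈ o.indices, (⟨A.1.fsmul (o.partition i), o.fsmul_isSmooth A.2 i⟩ :
      smoothForms n M E) := by
    refine Subtype.ext (funext fun x => ?_)
    rw [AddSubmonoidClass.coe_finsetSum, Finset.sum_apply]
    change A.1 x = ∑ i ∈ o.indices, o.partition i x • A.1 x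
    rw [← Finset.sum_smul, o.sum_partition, one_smul]
  rw [h, map_sum, map_sum]
  exact Finset.sum_eq_zero fun i _ => o.integral_tr_d_fsmul A.2 i

/-- Negation in this ring is by definition scalar multiplication by `-1`, the form in which
`scale_d` and `scale_eq` express signs. -/
instance smoothFormsRing : Ring (smoothForms n M E) := Algebra.semiringToRing ℝ

variable (E) in
/-- The smooth forms on a closed oriented manifold of odd dimension, with the integral of the
trace. -/
def smoothClosedTrace (hn : Odd n) : ClosedTrace (smoothForms n M E) where
  d := smoothD n M E
  invol := smoothInvol n M E
  int := smoothInt E o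
  leibniz A B := Subtype.ext (EndForm.IsSmooth.d_mul A.2 B.2)
  d_d A := Subtype.ext (EndForm.IsSmooth.d_d A.2)
  invol_d A := Subtype.ext (EndForm.IsSmooth.scale_d A.2 (-1))
  int_comm A B := o.integral_tr_mul_comm hn A.1 B.1
  int_d A := smoothInt_smoothD o A

end ManifoldIntegral

/-! ### The first variation of the Chern–Simons functional -/

section FirstVariation

variable {n : ℕ} {M : Type*} [TopologicalSpace M] [ChartedSpace (Coord n) M]
  {E : Type*} [AddCommGroup E] [Module ℝ E] [FiniteDimensional ℝ E]
  [T2Space M] [CompactSpace M] [IsManifold (𝓡 n) ∞ M] (o : OrientedAtlas n M)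

theorem coe_lift_lettersIn (A : smoothForms n M E) (x : FreeAlgebra ℝ Letter) :
    ((FreeAlgebra.lift ℝ (lettersIn (smoothD n M E) A) x : smoothForms n M E) : EndForm n M E) =
      EndForm.proj A.1 x := by
  have : (smoothForms n M E).val.comp (FreeAlgebra.lift ℝ (lettersIn (smoothD n M E) A)) =
      EndForm.proj A.1 := by
    refine FreeAlgebra.hom_ext (funext fun l => ?_)
    rw [Function.comp_apply, Function.comp_apply, AlgHom.comp_apply, FreeAlgebra.lift_ι_apply,
      EndForm.proj, FreeAlgebra.lift_ι_apply]
    cases l <;> rfl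
  exact DFunLike.congr_fun this x

theorem hasDerivAt_chernSimons (hn : Odd n) (K : ℕ) {A η : EndForm n M E} (hA : A.IsSmooth)
    (hA1 : EndForm.scale n M E (-1) A = (-1 : ℝ) • A) (hη : η.IsSmooth) :
    HasDerivAt (fun t : ℝ => chernSimons o K (A + t • η))
      (2 * (K : ℝ) * o.integral (EndForm.tr (η * A.curvature ^ K))) 0 := by
  have h := ((smoothClosedTrace E o hn).hasDerivAt_int (a := ⟨A, hA⟩) (Subtype.ext hA1)
    ⟨η, hη⟩ K).const_mul (2 * (K : ℝ))
  refine (h.congr_of_eventuallyEq (Filter.Eventually.of_forall fun t => ?_)).congr_deriv ?_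
  · have := coe_lift_lettersIn (⟨A, hA⟩ + t • ⟨η, hη⟩ : smoothForms n M E) (sharpInv (csElem K))
    rw [chernSimons]
    exact congrArg (fun B : EndForm n M E => 2 * (K : ℝ) * o.integral B.tr) this.symm
  · rfl

end FirstVariation

/-! ### Test forms supported in a chart -/

section TestForms

open MeasureTheory

variable {n : ℕ} {M : Type*} [TopologicalSpace M] [ChartedSpace (Coord n) M]
  {E : Type*} [AddCommGroup E] [Module ℝ E]

theorem pullScalar_mem {S T : Type*} [AddCommGroup S] [Module ℝ S] [AddCommGroup T] [Module ℝ T]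
    (B : S →ₗ[ℝ] T) {k : ℕ} {a : ScalarFiber T} (ha : a ∈ ⋀[ℝ]^k (Module.Dual ℝ T)) :
    pullScalar B a ∈ ⋀[ℝ]^k (Module.Dual ℝ S) := by
  rw [← ExteriorAlgebra.ιMulti_span_fixedDegree] at ha
  induction ha using Submodule.span_induction with
  | mem a ha =>
    obtain ⟨v, rfl⟩ := ha
    rw [pullScalar, ExteriorAlgebra.map_apply_ιMulti]
    exact ExteriorAlgebra.ιMulti_range ℝ k ⟨_, rfl⟩
  | zero => rw [map_zero]; exact Submodule.zero_mem _
  | add a b _ _ ha hb => rw [map_add]; exact Submodule.add_mem _ ha hb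
  | smul r a _ ha => rw [map_smul]; exact Submodule.smul_mem _ r ha

theorem tmul_mem_fiberDegree {T : Type*} [AddCommGroup T] [Module ℝ T] {k : ℕ}
    {a : ScalarFiber T} (ha : a ∈ ⋀[ℝ]^k (Module.Dual ℝ T)) (ψ : Module.End ℝ E) :
    a ⊗ₜ[ℝ] ψ ∈ fiberDegree T E k :=
  ⟨⟨a, ha⟩ ⊗ₜ[ℝ] ψ, rfl⟩

theorem pullEnd_mem_fiberDegree {S T : Type*} [AddCommGroup S] [Module ℝ S] [AddCommGroup T]
    [Module ℝ T] (B : S →ₗ[ℝ] T) {k : ℕ} {v : EndFiber T E} (hv : v ∈ fiberDegree T E k) :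
    pullEnd E B v ∈ fiberDegree S E k := by
  obtain ⟨w, rfl⟩ := hv
  induction w using TensorProduct.induction_on with
  | zero => rw [map_zero, map_zero]; exact Submodule.zero_mem _
  | tmul a ψ =>
    rw [LinearMap.rTensor_tmul, pullEnd_tmul]
    exact tmul_mem_fiberDegree (pullScalar_mem B a.2) ψ
  | add v w hv hw => rw [map_add, map_add]; exact Submodule.add_mem _ hv hw

open Classical in
/-- The form that is `r u` in the chart `e`, extended by zero. -/
def EndForm.ofChart (e : OpenPartialHomeomorph M (Coord n)) (r : M → ℝ)
    (u : Coord n → EndFiber (Coord n) E) : EndForm n M E := fun x =>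
  if x ∈ e.source then r x • pullEnd E (derivChart e x) (u (e x)) else 0

variable {e : OpenPartialHomeomorph M (Coord n)} {r : M → ℝ} {u : Coord n → EndFiber (Coord n) E}

theorem EndForm.val_ofChart {x : M} (hx : x ∈ e.source) :
    (EndForm.ofChart e r u).val x = r x • pullEnd E (derivChart e x) (u (e x)) :=
  if_pos hx

theorem EndForm.val_ofChart_of_notMem {x : M} (hx : x ∉ e.source) :
    (EndForm.ofChart e r u).val x = 0 :=
  if_neg hx

theorem EndForm.val_ofChart_eq_zero {x : M} (hx : r x = 0) :
    (EndForm.ofChart e r u).val x = 0 := by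
  by_cases h : x ∈ e.source
  · rw [EndForm.val_ofChart h, hx, zero_smul]
  · exact EndForm.val_ofChart_of_notMem h

theorem EndForm.inChart_ofChart (he : e ∈ IsManifold.maximalAtlas (𝓡 n) ∞ M) {y : Coord n}
    (hy : y ∈ e.target) : (EndForm.ofChart e r u).inChart e y = r (e.symm y) • u y := by
  have hyU : y ∈ (e.symm.trans e).source := by
    rw [OpenPartialHomeomorph.trans_source]
    exact ⟨hy, e.map_target hy⟩
  have hid : fderiv ℝ (e ∘ e.symm) y = ContinuousLinearMap.id ℝ _ := by
    have : e ∘ e.symm =ᶠ[nhds y] id := by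
      filter_upwards [e.open_target.mem_nhds hy] with z hz
      exact e.right_inv hz
    rw [this.fderiv_eq, fderiv_id]
  rw [EndForm.inChart_eq, EndForm.val_ofChart (e.map_target hy), map_smul, ← pullEnd_comp,
    derivChart_comp_derivSymm he he hyU, hid, e.right_inv hy]
  congr 1
  exact pullEnd_id E (u y)

theorem EndForm.isOfDegree_ofChart {k : ℕ} (hu : ∀ y, u y ∈ fiberDegree (Coord n) E k) :
    (EndForm.ofChart e r u).IsOfDegree k := by
  intro x
  change (EndForm.ofChart e r u).val x ∈ fiberDegree (Coord n) E k
  by_cases h : x ∈ e.source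
  · rw [EndForm.val_ofChart h]
    exact Submodule.smul_mem _ _ (pullEnd_mem_fiberDegree _ (hu _))
  · rw [EndForm.val_ofChart_of_notMem h]
    exact Submodule.zero_mem _

variable [FiniteDimensional ℝ E] [IsManifold (𝓡 n) ∞ M]

/-- At points of `e.source` the form is pulled back from the chart `e`. Any other point has a
neighbourhood that misses the closed support of `r`, where the form is zero. -/
theorem EndForm.isSmooth_ofChart (he : e ∈ IsManifold.maximalAtlas (𝓡 n) ∞ M)
    (hr : ContMDiff (𝓡 n) 𝓘(ℝ) ∞ r) (hre : tsupport r ⊆ e.source)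
    (hu : ContDiffOn ℝ ∞ u e.target) : (EndForm.ofChart e r u).IsSmooth := by
  refine EndForm.isSmooth_of_contDiffOn fun c hc z hz => ?_
  have hc' := mem_maximalAtlas_of_mem_atlas hc
  by_cases hx : c.symm z ∈ e.source
  · have hzU : z ∈ (c.symm.trans e).source := by
      rw [OpenPartialHomeomorph.trans_source]
      exact ⟨hz, hx⟩
    have hre : ContDiffOn ℝ ∞ (fun y => r (e.symm y)) e.target := by
      rw [← contMDiffOn_iff_contDiffOn]
      exact hr.comp_contMDiffOn (contMDiffOn_symm_of_mem_maximalAtlas he)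
    have hs : ContDiffOn ℝ ∞ ((EndForm.ofChart e r u).inChart e) e.target :=
      (hre.smul hu).congr fun y hy => EndForm.inChart_ofChart he hy
    have h := contDiffOn_pullAlong (c.symm.trans e).open_source (contDiffOn_transition hc' he) hs
      fun y hy => by
        rw [OpenPartialHomeomorph.trans_source] at hy
        exact e.map_source hy.2
    have hopen := (c.symm.trans e).open_source.mem_nhds hzU
    refine ((h.contDiffAt hopen).congr_of_eventuallyEq ?_).contDiffWithinAt
    filter_upwards [hopen] with y hy
    exact EndForm.inChart_eq_pullAlong _ hc' he hy
  · have hopen : c.symm ⁻¹' (tsupport r)ᶜ ∈ nhds z :=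
      (c.continuousAt_symm hz).preimage_mem_nhds
        ((isClosed_tsupport r).isOpen_compl.mem_nhds fun h => hx (hre h))
    refine ((contDiffAt_const (c := (0 : EndFiber (Coord n) E))).congr_of_eventuallyEq
      ?_).contDiffWithinAt
    filter_upwards [hopen] with y hy
    exact EndForm.inChart_eq_zero
      (EndForm.val_ofChart_eq_zero (image_eq_zero_of_notMem_tsupport hy))

variable [T2Space M] [CompactSpace M] (o : OrientedAtlas n M)

namespace OrientedAtlas

/-- The variation supported in the `i`-th chart that detects the components of `G` dual to the
basis elements in `P`. -/
def testForm (G : EndForm n M E) (i : M)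
    (P : Finset (Finset (Fin n) × Fin (Module.finrank ℝ (Module.End ℝ E)))) : EndForm n M E :=
  EndForm.ofChart (o.chart i) (o.partition i) fun y => ∑ p ∈ P,
    topTr n E (coordBasis n E p * G.inChart (o.chart i) y) • coordBasis n E p

variable {G : EndForm n M E}
  {P : Finset (Finset (Fin n) × Fin (Module.finrank ℝ (Module.End ℝ E)))}

theorem contDiffOn_topTr_mul (hG : G.IsSmooth) (i : M) (v : EndFiber (Coord n) E) :
    ContDiffOn ℝ ∞ (fun y => topTr n E (v * G.inChart (o.chart i) y)) (o.chart i).target :=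
  (contDiff_linearMap (topTr n E)).comp_contDiffOn
    (contDiffOn_mul contDiffOn_const (hG.contDiffOn (o.chart_mem_maximalAtlas i)))

theorem isSmooth_testForm (hG : G.IsSmooth) (i : M) : (o.testForm G i P).IsSmooth :=
  EndForm.isSmooth_ofChart (o.chart_mem_maximalAtlas i) (o.partition i).contMDiff
    (o.tsupport_subset i) (ContDiffOn.sum fun p _ => ContDiffOn.smul
      (o.contDiffOn_topTr_mul hG i (coordBasis n E p)) contDiffOn_const)

theorem isOfDegree_testForm {k : ℕ} (hP : ∀ p ∈ P, p.1.card = k) (i : M) :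
    (o.testForm G i P).IsOfDegree k := by
  refine EndForm.isOfDegree_ofChart fun y => Submodule.sum_mem _ fun p hp =>
    Submodule.smul_mem _ _ ?_
  rw [← Prod.mk.eta (p := p), coordBasis_apply, ← hP p hp]
  exact tmul_mem_fiberDegree (dxI_mem n p.1) _

/-- By the choice of the test form the integrand is `ρᵢ` times a sum of squares. It is continuous
and nonnegative with integral zero, so it vanishes identically on the chart, and so does each square
where `ρᵢ ≠ 0`. -/
theorem topTr_mul_eq_zero_of_integral_testForm (hG : G.IsSmooth) (i : M)
    (h : o.integral (o.testForm G i P * G).tr = 0) {y : Coord n} (hy : y ∈ (o.chart i).target)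
    (hρ : o.partition i ((o.chart i).symm y) ≠ 0) {p} (hp : p ∈ P) :
    topTr n E (coordBasis n E p * G.inChart (o.chart i) y) = 0 := by
  set e := o.chart i with he_def
  have he : e ∈ IsManifold.maximalAtlas (𝓡 n) ∞ M := o.chart_mem_maximalAtlas i
  have hs : (o.testForm G i P * G).IsSmooth :=
    (smoothForms n M E).mul_mem (o.isSmooth_testForm hG i) hG
  have h0 : ∀ x, x ∉ tsupport (o.partition i) → (o.testForm G i P * G).val x = 0 := by
    intro x hx
    have : (o.testForm G i P).val x = 0 :=
      EndForm.val_ofChart_eq_zero (image_eq_zero_of_notMem_tsupport hx)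
    change (o.testForm G i P).val x * G.val x = 0
    rw [this, zero_mul]
  have hval : ∀ y ∈ e.target, topTr n E ((o.testForm G i P * G).inChart e y) =
      o.partition i (e.symm y) * ∑ p ∈ P,
        topTr n E (coordBasis n E p * G.inChart e y) ^ 2 := by
    intro y hy
    rw [EndForm.inChart_mul, testForm, EndForm.inChart_ofChart he hy, smul_mul_assoc, map_smul,
      smul_eq_mul, Finset.sum_mul, map_sum]
    congr 1
    refine Finset.sum_congr rfl fun p _ => ?_
    rw [smul_mul_assoc, map_smul, smul_eq_mul, pow_two]
  have hnn : ∀ y ∈ e.target, 0 ≤ topTr n E ((o.testForm G i P * G).inChart e y) := by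
    intro y hy
    rw [hval y hy]
    exact mul_nonneg (o.partition.nonneg i _) (Finset.sum_nonneg fun p _ => sq_nonneg _)
  have hcont : ContinuousOn (fun y => topTr n E ((o.testForm G i P * G).inChart e y)) e.target :=
    ((contDiff_linearMap (topTr n E)).comp_contDiffOn (hs.contDiffOn he)).continuousOn
  rw [o.integral_tr_of_support hs i h0, EndForm.chartIntegral,
    setIntegral_eq_zero_iff_of_nonneg_ae
      ((ae_restrict_iff' e.open_target.measurableSet).2 (Filter.Eventually.of_forall hnn))
      (hs.integrableOn he (isClosed_tsupport _) (o.tsupport_subset i) h0)] at h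
  have hzero := Measure.eqOn_open_of_ae_eq h e.open_target hcont continuousOn_const hy
  simp only [Pi.zero_apply] at hzero
  rw [hval y hy] at hzero
  have hsum := (mul_eq_zero.1 hzero).resolve_left hρ
  exact pow_eq_zero_iff two_ne_zero |>.1
    ((Finset.sum_eq_zero_iff_of_nonneg fun p _ => sq_nonneg _).1 hsum p hp)

/-- A form vanishes if its coefficients vanish where the partition of unity does not. -/
theorem eq_zero_of_inChart (h : ∀ i, ∀ y ∈ (o.chart i).target,
    o.partition i ((o.chart i).symm y) ≠ 0 → G.inChart (o.chart i) y = 0) : G = 0 := by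
  refine EndForm.ext_val fun x => ?_
  obtain ⟨i, hi⟩ := o.partition.exists_pos_of_mem (Set.mem_univ x)
  have hx : x ∈ (o.chart i).source := o.tsupport_subset i (subset_tsupport _ hi.ne')
  rw [G.val_eq_pullEnd_inChart (o.chart_mem_maximalAtlas i) hx,
    h i _ ((o.chart i).map_source hx) (by rw [(o.chart i).left_inv hx]; exact hi.ne'), map_zero]
  rfl

/-- The pairing `(η, G) ↦ ∫ Tr(η G)` is nondegenerate. -/
theorem eq_zero_of_integral (hG : G.IsSmooth)
    (h : ∀ η : EndForm n M E, η.IsSmooth → o.integral (η * G).tr = 0) : G = 0 :=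
  o.eq_zero_of_inChart fun i _ hy hρ => eq_zero_of_topTr_mul n fun p =>
    o.topTr_mul_eq_zero_of_integral_testForm (P := Finset.univ) hG i
      (h _ (o.isSmooth_testForm hG i)) hy hρ (Finset.mem_univ p)

end OrientedAtlas

/-- Forms of degree `n - 1` are separated by their integrals against one-forms. -/
theorem OrientedAtlas.eq_zero_of_integral_oneForms {k : ℕ} {M : Type*} [TopologicalSpace M]
    [ChartedSpace (Coord (k + 1)) M] [IsManifold (𝓡 (k + 1)) ∞ M] [T2Space M] [CompactSpace M]
    (o : OrientedAtlas (k + 1) M) {G : EndForm (k + 1) M E} (hG : G.IsSmooth)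
    (hGk : EndForm.scale (k + 1) M E 2 G = (2 : ℝ) ^ k • G)
    (h : ∀ η : EndForm (k + 1) M E, η.IsSmooth → η.IsOfDegree 1 → o.integral (η * G).tr = 0) :
    G = 0 := by
  classical
  let P : Finset (Finset (Fin (k + 1)) × Fin (Module.finrank ℝ (Module.End ℝ E))) :=
    Finset.univ.filter fun p => p.1.card = 1
  have hP : ∀ p ∈ P, p.1.card = 1 := fun p hp => (Finset.mem_filter.1 hp).2
  refine o.eq_zero_of_inChart fun i y hy hρ =>
    eq_zero_of_topTr_mul_of_degree ?_ fun I a hI =>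
      o.topTr_mul_eq_zero_of_integral_testForm (P := P) hG i
        (h _ (o.isSmooth_testForm hG i) (o.isOfDegree_testForm hP i)) hy hρ
        (Finset.mem_filter.2 ⟨Finset.mem_univ _, hI⟩)
  rw [← EndForm.inChart_scale, hGk, EndForm.inChart_const_smul]

end TestForms

/-! ### Degrees of a form and of the powers of its curvature -/

section Degree

variable {n : ℕ} {M : Type*} [TopologicalSpace M] [ChartedSpace (Coord n) M]
  {E : Type*} [AddCommGroup E] [Module ℝ E]

theorem EndForm.IsOfDegree.scale_eq {A : EndForm n M E} {k : ℕ} (hA : A.IsOfDegree k) (r : ℝ) :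
    EndForm.scale n M E r A = r ^ k • A :=
  funext fun x => scaleEnd_of_mem_fiberDegree E r (hA x)

theorem EndForm.IsOdd.scale_eq {A : EndForm n M E} (hA : A.IsOdd) :
    EndForm.scale n M E (-1) A = (-1 : ℝ) • A :=
  funext fun x => (scaleEnd_neg_one_of_mem_fiberOdd E (hA x)).trans (neg_one_smul ℝ (A x)).symm

variable [FiniteDimensional ℝ E] [IsManifold (𝓡 n) ∞ M]

theorem EndForm.IsSmooth.curvature {A : EndForm n M E} (hA : A.IsSmooth) : A.curvature.IsSmooth :=
  (smoothForms n M E).add_mem hA.d ((smoothForms n M E).mul_mem hA hA)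

/-- Says that `F^K` has degree `2K`, as an eigenvalue equation for `scale`. This form follows at
once from multiplicativity and from the commutation of `scale` with `d`. -/
theorem EndForm.scale_curvature_pow {A : EndForm n M E} (hA : A.IsSmooth) (hA1 : A.IsOfDegree 1)
    (r : ℝ) (K : ℕ) :
    EndForm.scale n M E r (A.curvature ^ K) = r ^ (2 * K) • A.curvature ^ K := by
  have h1 : EndForm.scale n M E r A = r • A := by rw [hA1.scale_eq, pow_one]
  have h2 : EndForm.scale n M E r A.d = r ^ 2 • A.d := by
    rw [hA.scale_d, h1, hA.d_smul, smul_smul, pow_two]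
  have h3 : EndForm.scale n M E r A.curvature = r ^ 2 • A.curvature := by
    rw [EndForm.curvature, map_add, map_mul, h1, h2, smul_mul_smul_comm, ← pow_two, smul_add]
  have h4 : EndForm.scale n M E r (A.curvature ^ K) = (EndForm.scale n M E r A.curvature) ^ K :=
    (EndForm.scale n M E r).map_pow _ _
  rw [h4, h3, pow_mul]
  exact smul_pow (r ^ 2) A.curvature K

end Degree

end NFlat

end

/-! ### The two equivalences -/

theorem theorem14 (K : ℕ) (hK : 1 ≤ K)
    (M : Type*) [TopologicalSpace M] [T2Space M] [CompactSpace M]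
    [ChartedSpace (EuclideanSpace ℝ (Fin (2 * K + 1))) M] [IsManifold (𝓡 (2 * K + 1)) ∞ M]
    (o : NFlat.OrientedAtlas (2 * K + 1) M)
    (E : Type*) [AddCommGroup E] [Module ℝ E] [FiniteDimensional ℝ E] :
    (∀ A : NFlat.EndForm (2 * K + 1) M E, A.IsSmooth → A.IsOdd →
      (NFlat.IsCriticalPoint (NFlat.chernSimons o K) {η | η.IsSmooth} A ↔
        A.curvature ^ K = 0)) ∧
    (∀ A : NFlat.EndForm (2 * K + 1) M E, A.IsSmooth → A.IsOfDegree 1 →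
      (NFlat.IsCriticalPoint (NFlat.chernSimons o K) {η | η.IsSmooth ∧ η.IsOfDegree 1} A ↔
        A.curvature ^ K = 0)) := by
  have hn : Odd (2 * K + 1) := odd_two_mul_add_one K
  have hK' : (2 * (K : ℝ)) ≠ 0 := by positivity
  have hpow : ∀ A : NFlat.EndForm (2 * K + 1) M E, A.IsSmooth → (A.curvature ^ K).IsSmooth :=
    fun A hA => (NFlat.smoothForms (2 * K + 1) M E).pow_mem hA.curvature K
  -- Uniqueness of derivatives turns criticality into the vanishing of the first variation; the
  -- factor `2K` is cancelled.
  have hback : ∀ (A : NFlat.EndForm (2 * K + 1) M E) (D : Set (NFlat.EndForm (2 * K + 1) M E)),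
      A.IsSmooth → NFlat.EndForm.scale (2 * K + 1) M E (-1) A = (-1 : ℝ) • A →
      (∀ η ∈ D, η.IsSmooth) → (NFlat.IsCriticalPoint (NFlat.chernSimons o K) D A ↔
        ∀ η ∈ D, o.integral (NFlat.EndForm.tr (η * A.curvature ^ K)) = 0) := by
    intro A D hA hA1 hD
    refine forall₂_congr fun η hη => ?_
    have h := NFlat.hasDerivAt_chernSimons o hn K hA hA1 (hD η hη)
    refine ⟨fun h0 => (mul_eq_zero.1 (h.unique h0)).resolve_left hK', fun h0 => ?_⟩
    rwa [h0, mul_zero] at h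
  have hzero : o.integral (NFlat.EndForm.tr (0 : NFlat.EndForm (2 * K + 1) M E)) = 0 := by
    have := o.integral_tr_smul (0 : ℝ) (0 : NFlat.EndForm (2 * K + 1) M E)
    rwa [zero_smul, zero_mul] at this
  refine ⟨fun A hA hodd => ?_, fun A hA hdeg => ?_⟩
  · rw [hback A {η | η.IsSmooth} hA hodd.scale_eq fun η hη => hη]
    refine ⟨fun h => o.eq_zero_of_integral (hpow A hA) h, fun h η _ => ?_⟩
    rw [h, mul_zero, hzero]
  · rw [hback A {η | η.IsSmooth ∧ η.IsOfDegree 1} hA (by rw [hdeg.scale_eq, pow_one])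
      fun η hη => hη.1]
    refine ⟨fun h => o.eq_zero_of_integral_oneForms (hpow A hA)
      (NFlat.EndForm.scale_curvature_pow hA hdeg 2 K) fun η h1 h2 => h η ⟨h1, h2⟩,
      fun h η _ => ?_⟩
    rw [h, mul_zero, hzero]
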